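/- Write $\mathbb{R}^3_-=\{x\in\mathbb{R}^3 : x_3<0\}$, with boundary $\partial\mathbb{R}^3_-=\{x_3=0\}$ and outer unit normal $n=(0,0,1)$. Let $k>0$. Let $A$ be the restriction to $\overline{\mathbb{R}^3_-}$ of a compactly supported vector field in $W^{1,\infty}(\mathbb{R}^3,\mathbb{R}^3)$ (taken in its Lipschitz representative), let $q\in L^\infty(\mathbb{R}^3_-,\mathbb{C})$ have compact support in $\overline{\mathbb{R}^3_-}$, and put $$L_{A,q}=\sum_{j=1}^3\big(-i\partial_j+A_j\big)^2+q .$$ Let $H^2_{\rm loc}(\overline{\mathbb{R}^3_-})$ be the space of functions on $\mathbb{R}^3_-$ whose weak derivatives of order at most $2$ are square integrable on every bounded part of $\mathbb{R}^3_-$. A function $w\in H^2_{\rm loc}(\overline{\mathbb{R}^3_-})$ is called outgoing if $$\lim_{|x|\to\infty}|x|\Big(\frac{\partial w}{\partial|x|}(x)-ikw(x)\Big)=0$$ in $\mathbb{R}^3_-$, uniformly in the direction $x/|x|$ (as an essential limit), and incoming if this holds with $-ik$ replaced by $ik$. Boundary values are understood in the sense of traces, and $(f,g)_{L^2}=\int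 f\,\overline g$. Let $u\in H^2_{\rm loc}(\overline{\mathbb{R}^3_-})$ be outgoing, with $(L_{A,q}-k^2)u=0$ in $\mathbb{R}^3_-$ and $\operatorname{supp}(u|_{\partial\mathbb{R}^3_-})$ compact. Let $v\in H^2_{\rm loc}(\overline{\mathbb{R}^3_-})$ be incoming, with $(L_{A,\overline q}-k^2)v$ in $L^2(\mathbb{R}^3_-)$ and of compact support in $\overline{\mathbb{R}^3_-}$, and with $\operatorname{supp}(v|_{\partial\mathbb{R}^3_-})$ compact. Then the integrands of the four pairings below are integrable, and $$\big((L_{A,q}-k^2)u,v\big)_{L^2(\mathbb{R}^3_-)}-\big(u,(L_{A,\overline q}-k^2)v\big)_{L^2(\mathbb{R}^3_-)} =\big(u,(\partial_n+iA\cdot n)v\big)_{L^2(\partial\mathbb{R}^3_-)}-\big((\partial_n+iA\cdot n)u,v\big)_{L^2(\partial\mathbb{R}^3_-)} .$$ -/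

import Mathlib

open MeasureTheory Filter Topology
open scoped ContDiff

noncomputable section

namespace HalfSpace

/-- Three-dimensional Euclidean space. -/
abbrev E3 := EuclideanSpace ℝ (Fin 3)

/-- The Euclidean plane, which parametrizes the boundary `{x₃ = 0}`. -/
abbrev E2 := EuclideanSpace ℝ (Fin 2)

/-- The open lower half space `{x : x₃ < 0}` (coordinates are numbered from `0`). -/
def lowerHalf : Set E3 := {x | x 2 < 0}

/-- Lebesgue measure on the lower half space. -/
def volH : Measure E3 := volume.restrict lowerHalf

/-- The point `(y₁, y₂, t)`. -/
def pt (y : E2) (t : ℝ) : E3 := !₂[y 0, y 1, t]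

/-- `f` vanishes almost everywhere outside some compact set, i.e. the support of the class of `f`
is compact. -/
def EssCompactSupport {X : Type*} [TopologicalSpace X] [MeasurableSpace X]
    (f : X → ℂ) (μ : Measure X) : Prop :=
  ∃ K : Set X, IsCompact K ∧ ∀ᵐ x ∂μ, x ∉ K → f x = 0

/-- `g` is the weak (distributional) partial derivative `∂ⱼ u` in the open lower half space. -/
def HasWeakPartial (j : Fin 3) (u g : E3 → ℂ) : Prop :=
  LocallyIntegrableOn u lowerHalf volume ∧ LocallyIntegrableOn g lowerHalf volume ∧
    ∀ φ : E3 → ℝ, ContDiff ℝ ∞ φ → HasCompactSupport φ → tsupport φ ⊆ lowerHalf →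
      ∫ x, (fderiv ℝ φ x (EuclideanSpace.single j 1)) • u x ∂volH = -∫ x, φ x • g x ∂volH

open Classical in
/-- The weak partial derivative `∂ⱼ u` in the lower half space: it is unique up to null sets,
and is set to be `0` when there is none. -/
def weakPartial (j : Fin 3) (u : E3 → ℂ) : E3 → ℂ :=
  if h : ∃ g, HasWeakPartial j u g then h.choose else 0

/-- `L²_loc` of the closed half space: square integrable on every bounded part of the half space,
up to the boundary. -/
def MemL2loc (u : E3 → ℂ) : Prop :=
  ∀ R : ℝ, MemLp u 2 (volume.restrict (lowerHalf ∩ Metric.ball 0 R))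

/-- `H¹_loc` of the closed half space. -/
def MemH1loc (u : E3 → ℂ) : Prop :=
  MemL2loc u ∧ ∀ j, ∃ g, HasWeakPartial j u g ∧ MemL2loc g

/-- `H²_loc` of the closed half space. -/
def MemH2loc (u : E3 → ℂ) : Prop :=
  MemL2loc u ∧ ∀ j, ∃ g, HasWeakPartial j u g ∧ MemH1loc g

/-- `L²_comp` of the closed half space. -/
def MemL2comp (f : E3 → ℂ) : Prop :=
  MemLp f 2 volH ∧ EssCompactSupport f volH

/-- `L^∞_comp` of the closed half space. -/
def MemLinfComp (q : E3 → ℂ) : Prop :=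
  MemLp q ⊤ volH ∧ EssCompactSupport q volH

/-- `A` is the continuous representative of an element of `W^{1,∞}(ℝ³, ℝ³)` with compact support,
that is, a Lipschitz vector field with compact support (which is then bounded). -/
def MemW1infComp (A : E3 → E3) : Prop :=
  (∃ C, LipschitzWith C A) ∧ HasCompactSupport A

/-- `f` is the trace on the boundary plane `{x₃ = 0}` of the function `u` on the lower half space:
`f` is in `L²_loc` of the plane, and the restrictions of `u` to the parallel planes `{x₃ = -t}`
(defined for almost every `t > 0`, as `u` is a class of functions) tend to `f` in `L²_loc`
as `t → 0+`. -/
def IsTrace (u : E3 → ℂ) (f : E2 → ℂ) : Prop :=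
  ∀ R : ℝ, MemLp f 2 (volume.restrict (Metric.ball 0 R)) ∧
    Tendsto (fun t : ℝ => eLpNorm (fun y => u (pt y (-t)) - f y) 2
      (volume.restrict (Metric.ball 0 R))) (𝓝[>] 0 ⊓ ae volume) (𝓝 0)

open Classical in
/-- The trace of `u` on the boundary plane: it is unique up to null sets, it exists for every `u`
in `H¹_loc` of the closed half space, and is set to be `0` when there is none. -/
def boundaryTrace (u : E3 → ℂ) : E2 → ℂ :=
  if h : ∃ f, IsTrace u f then h.choose else 0

/-- The magnetic derivative `(-i ∂ⱼ + Aⱼ) u`. -/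
def magPartial (A : E3 → E3) (j : Fin 3) (u : E3 → ℂ) : E3 → ℂ :=
  fun x => -Complex.I * weakPartial j u x + (A x j : ℂ) * u x

/-- The magnetic Schrödinger operator `L_{A,q} u = ∑ⱼ (-i ∂ⱼ + Aⱼ)² u + q u`. -/
def magneticSchrodinger (A : E3 → E3) (q : E3 → ℂ) (u : E3 → ℂ) : E3 → ℂ :=
  fun x => (∑ j, magPartial A j (magPartial A j u) x) + q x * u x

/-- `(L_{A,q} - k²) u`. -/
def helmholtz (A : E3 → E3) (q : E3 → ℂ) (k : ℝ) (u : E3 → ℂ) : E3 → ℂ :=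
  fun x => magneticSchrodinger A q u x - (k : ℂ) ^ 2 * u x

/-- The radial derivative `∂u/∂|x| = (x / |x|) · ∇u`. -/
def radialDeriv (u : E3 → ℂ) : E3 → ℂ :=
  fun x => ∑ j, ((x j / ‖x‖ : ℝ) : ℂ) * weakPartial j u x

/-- The Sommerfeld condition `|x| (∂u/∂|x| - i κ u) → 0` as `|x| → ∞` in the half space, uniformly
in the direction, for the (almost everywhere defined) functions `u` and `∂u/∂|x|`. -/
def Sommerfeld (κ : ℝ) (u : E3 → ℂ) : Prop :=
  Tendsto (fun x : E3 => (‖x‖ : ℂ) * (radialDeriv u x - Complex.I * (κ : ℂ) * u x))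
    (Bornology.cobounded E3 ⊓ ae volH) (𝓝 0)

/-- The outgoing radiation condition with wave number `k`. -/
def Outgoing (k : ℝ) (u : E3 → ℂ) : Prop := Sommerfeld k u

/-- The incoming radiation condition: `-ik` is replaced by `ik`. -/
def Incoming (k : ℝ) (u : E3 → ℂ) : Prop := Sommerfeld (-k) u

/-- The magnetic normal derivative `(∂ₙ + i A·n) u` on the boundary plane, where `n = (0,0,1)` is
the outer unit normal of the lower half space. -/
def magNormalDeriv (A : E3 → E3) (u : E3 → ℂ) : E2 → ℂ :=
  fun y => boundaryTrace (weakPartial 2 u) y +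
    Complex.I * (A (pt y 0) 2 : ℂ) * boundaryTrace u y

/-- The integrand `f ḡ` of the `L²` pairing `(f, g)`. -/
def mulConj {X : Type*} (f g : X → ℂ) : X → ℂ := fun x => f x * (starRingEnd ℂ) (g x)

end HalfSpace

end

open scoped ENNReal ComplexConjugate

noncomputable section

namespace HalfSpace

/-! The identity is Green's formula for the magnetic Laplacian on a half ball with a smoothed edge,
in the limit of infinite radius. Three facts carry it.

Integration by parts up to the boundary. A function of bounded support is a.e. the integral of its
weak derivative along a ray (`WeakDerivOn.ae_eq_segInt`). Inserting this in `a * w + p * b`, where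
`a`, `b` are the derivatives of `p`, `w`, and exchanging the integrals by Fubini turns the two rays
into a full line (`integral_mul_segInt_add`). In tangential directions the integral of `b` over the
line is zero. In the vertical direction, with `a` and `b` extended by zero, the line integrals are
the boundary traces, and the product of the traces remains (`integral_mul_add_eq_lineTrace`,
`isTrace_lineTrace`). Since `A` is real, each `-i∂ⱼ + Aⱼ` is formally symmetric, and two
applications per direction give the localized Green formula `integral_sum_greenTerm`.

Bounded mean squares. With a radial cutoff the gradient term is a smoothed flux through large
spheres, where `A = 0`. For a radiating `w` paired with itself, Green's formula bounds this flux
independently of `R`, because the volume and boundary densities are integrable. The expansion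
`sq_norm_radiation` then bounds the averages of `‖w‖ ^ 2` (`exists_bound_weight_norm_sq`).

Vanishing flux. For `u` outgoing and `v` incoming, the terms `± i k u v̄` cancel in the flux. What
is left is linear in the radiation errors `o(1/|x|)`, so by the mean square bounds the flux tends to
zero (`tendsto_weight_flux`). The other terms converge by dominated convergence
(`integral_greenDensity_eq`). On the boundary each product has one compactly supported factor, the
trace of `u` or of `v`; the normal derivatives need not have compact support. -/

/-- `g` is the distributional derivative of `u` in the direction `e` on `Ω`. -/
def WeakDerivOn (Ω : Set E3) (e : E3) (u g : E3 → ℂ) : Prop :=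
  ∀ φ : E3 → ℝ, ContDiff ℝ ∞ φ → HasCompactSupport φ → tsupport φ ⊆ Ω →
    ∫ x, (fderiv ℝ φ x e) • u x = -∫ x, φ x • g x

theorem WeakDerivOn.neg_dir {Ω : Set E3} {e : E3} {u g : E3 → ℂ} (h : WeakDerivOn Ω e u g) :
    WeakDerivOn Ω (-e) u (fun x => -g x) := by
  intro φ h1 h2 h3
  have := h φ h1 h2 h3
  simp only [map_neg, neg_smul, smul_neg, integral_neg]
  rw [this]

/-! ### Primitives along segments and Fubini's theorem. -/

/-- The integral of a test function along the segments `x + [0, S] e`. -/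
def segPotential (e : E3) (S : ℝ) (φ : E3 → ℝ) (x : E3) : ℝ := ∫ s in Set.Ioc 0 S, φ (x + s • e)

/-- Averaging over a segment is convolution with a finite measure, the image of Lebesgue measure on
`(0, S]` under `s ↦ -s e`; smoothness comes from the factor `φ`. -/
theorem contDiff_segPotential (e : E3) (S : ℝ) {φ : E3 → ℝ} (hφ : ContDiff ℝ ∞ φ)
    (hc : HasCompactSupport φ) : ContDiff ℝ ∞ (segPotential e S φ) := by
  set ν : Measure E3 := (volume.restrict (Set.Ioc 0 S)).map (fun s : ℝ => -(s • e)) with hν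
  have hm : Measurable (fun s : ℝ => -(s • e)) := by fun_prop
  have : segPotential e S φ =
      MeasureTheory.convolution (fun _ => (1 : ℝ)) φ (ContinuousLinearMap.lsmul ℝ ℝ) ν := by
    ext x
    rw [MeasureTheory.convolution, hν, integral_map hm.aemeasurable]
    · simp [segPotential]
    · have := hφ.continuous
      fun_prop
  rw [this]
  have : IsFiniteMeasure ν := by rw [hν]; infer_instance
  exact hc.contDiff_convolution_right _ (locallyIntegrable_const _) hφ

/-- The compact set on the right gives compact support. It also shows that the potential is an
admissible test function on any open set stable under `x ↦ x - s e`. -/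
theorem tsupport_segPotential_subset (e : E3) (S : ℝ) {φ : E3 → ℝ} (hc : HasCompactSupport φ) :
    tsupport (segPotential e S φ) ⊆
      (fun p : E3 × ℝ => p.1 - p.2 • e) '' (tsupport φ ×ˢ Set.Icc 0 S) := by
  have hK : IsCompact ((fun p : E3 × ℝ => p.1 - p.2 • e) '' (tsupport φ ×ˢ Set.Icc 0 S)) :=
    (hc.isCompact.prod isCompact_Icc).image (by fun_prop)
  refine closure_minimal ?_ hK.isClosed
  intro x hx
  by_contra hn
  apply hx
  rw [segPotential]
  refine setIntegral_eq_zero_of_forall_eq_zero fun s hs => ?_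
  by_contra h0
  exact hn ⟨(x + s • e, s), ⟨subset_tsupport _ h0, hs.1.le, hs.2⟩, by simp⟩

theorem hasCompactSupport_segPotential (e : E3) (S : ℝ) {φ : E3 → ℝ} (hc : HasCompactSupport φ) :
    HasCompactSupport (segPotential e S φ) :=
  ((hc.isCompact.prod isCompact_Icc).image (by fun_prop)).of_isClosed_subset
    (isClosed_tsupport _) (tsupport_segPotential_subset e S hc)

theorem fderiv_segPotential (e : E3) {S : ℝ} (hS : 0 ≤ S) {φ : E3 → ℝ} (hφ : ContDiff ℝ ∞ φ)
    (hc : HasCompactSupport φ) (x : E3) :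
    fderiv ℝ (segPotential e S φ) x e = φ (x + S • e) - φ x := by
  have hcont : Continuous fun s : ℝ => φ (x + s • e) := by
    have := hφ.continuous
    fun_prop
  have h1 : HasDerivAt (fun r : ℝ => segPotential e S φ (x + r • e))
      (fderiv ℝ (segPotential e S φ) x e) 0 := by
    have hd : HasFDerivAt (segPotential e S φ) (fderiv ℝ (segPotential e S φ) x)
        (x + (0 : ℝ) • e) := by
      simpa using ((contDiff_segPotential e S hφ hc).differentiable (by simp) x).hasFDerivAt
    have hl : HasDerivAt (fun r : ℝ => x + r • e) e 0 := by
      simpa using ((hasDerivAt_id (0 : ℝ)).smul_const e).const_add x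
    exact hd.comp_hasDerivAt 0 hl
  -- Moving the base point by `r e` shifts the window of integration to `[r, r + S]`, so the
  -- derivative is a difference of endpoint values.
  have h2 : ∀ r : ℝ, segPotential e S φ (x + r • e) =
      (∫ s in (0 : ℝ)..(r + S), φ (x + s • e)) - ∫ s in (0 : ℝ)..r, φ (x + s • e) := by
    intro r
    rw [intervalIntegral.integral_interval_sub_left (hcont.intervalIntegrable _ _)
      (hcont.intervalIntegrable _ _), segPotential, ← intervalIntegral.integral_of_le hS]
    have := intervalIntegral.integral_comp_add_left (a := 0) (b := S)
      (fun s => φ (x + s • e)) r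
    simp only [add_zero] at this
    rw [← this]
    refine intervalIntegral.integral_congr fun s _ => ?_
    simp only [add_smul, add_assoc]
  have h3 : HasDerivAt (fun r : ℝ => segPotential e S φ (x + r • e)) (φ (x + S • e) - φ x) 0 := by
    simp_rw [h2]
    have ha : HasDerivAt (fun r : ℝ => ∫ s in (0 : ℝ)..(r + S), φ (x + s • e))
        (φ (x + S • e)) 0 := by
      have := (hcont.integral_hasStrictDerivAt 0 (0 + S)).hasDerivAt
      have h' := this.comp_add_const 0 S
      simpa using h'
    have hb : HasDerivAt (fun r : ℝ => ∫ s in (0 : ℝ)..r, φ (x + s • e)) (φ x) 0 := by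
      simpa using (hcont.integral_hasStrictDerivAt 0 (0 : ℝ)).hasDerivAt
    exact ha.sub hb
  exact h1.unique h3

/-- Since the shear preserves the product measure, `b (x - s e)` is jointly measurable and
integrable as soon as `b` is; this justifies the Fubini exchanges below. -/
theorem measurePreserving_shear (e : E3) (ν : Measure ℝ) [SFinite ν] :
    MeasurePreserving (fun p : ℝ × E3 => (p.1, p.2 - p.1 • e)) (ν.prod volume)
      (ν.prod volume) := by
  refine (MeasurePreserving.id ν).skew_product (g := fun s x => x - s • e) ?_ ?_
  · simp only [Function.uncurry_def]; fun_prop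
  · exact ae_of_all _ fun s => (measurePreserving_sub_right volume (s • e)).map_eq

theorem integrable_shear (e : E3) (ν : Measure ℝ) [IsFiniteMeasure ν] {b : E3 → ℂ}
    (hb : Integrable b) :
    Integrable (fun p : ℝ × E3 => b (p.2 - p.1 • e)) (ν.prod volume) :=
  (measurePreserving_shear e ν).integrable_comp_of_integrable (hb.comp_snd ν)

theorem memLp_shear (e : E3) (ν : Measure ℝ) [IsFiniteMeasure ν] {b : E3 → ℂ}
    (hb : MemLp b 2) :
    MemLp (fun p : ℝ × E3 => b (p.2 - p.1 • e)) 2 (ν.prod volume) :=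
  (hb.comp_snd ν).comp_measurePreserving (measurePreserving_shear e ν)

theorem integrable_mul_shear (e : E3) (ν : Measure ℝ) [IsFiniteMeasure ν] {a b : E3 → ℂ}
    (ha : MemLp a 2) (hb : MemLp b 2) :
    Integrable (fun p : ℝ × E3 => a p.2 * b (p.2 - p.1 • e)) (ν.prod volume) :=
  (ha.comp_snd ν).integrable_mul (memLp_shear e ν hb)

/-- The integral of `b` along the backward segment `x - [0, S] e`. -/
def segInt (e : E3) (S : ℝ) (b : E3 → ℂ) (x : E3) : ℂ := ∫ s in Set.Ioc 0 S, b (x - s • e)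

theorem integrable_segInt (e : E3) (S : ℝ) {b : E3 → ℂ} (hb : Integrable b) :
    Integrable (segInt e S b) :=
  (integrable_shear e (volume.restrict (Set.Ioc 0 S)) hb).integral_prod_right

/-- A function whose support is bounded in the direction `e` is the integral of its weak
derivative along the rays of direction `e`. -/
theorem WeakDerivOn.ae_eq_segInt {Ω : Set E3} (hΩ : IsOpen Ω) {e : E3} (he : ‖e‖ = 1)
    (hΩe : ∀ x ∈ Ω, ∀ s : ℝ, 0 ≤ s → x - s • e ∈ Ω) {u b : E3 → ℂ} (h : WeakDerivOn Ω e u b)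
    (hu : Integrable u) (hb : Integrable b) {R R₁ S : ℝ} (hR : 0 ≤ R) (hR₁ : 0 ≤ R₁)
    (hS : R + R₁ ≤ S) (hu0 : ∀ x, R ≤ ‖x‖ → u x = 0) :
    ∀ᵐ x, x ∈ Ω ∩ Metric.ball 0 R₁ → u x = segInt e S b x := by
  have hS0 : 0 ≤ S := by linarith
  have hI := integrable_segInt e S hb
  suffices H : ∀ᵐ x, x ∈ Ω ∩ Metric.ball 0 R₁ → u x - segInt e S b x = 0 by
    filter_upwards [H] with x hx hx' using sub_eq_zero.1 (hx hx')
  refine (hΩ.inter Metric.isOpen_ball).ae_eq_zero_of_integral_contDiff_smul_eq_zero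
    ((hu.sub hI).locallyIntegrable.locallyIntegrableOn _) ?_
  intro φ hφ hc hsupp
  have hφc := hφ.continuous
  have hbd : ∃ C, ∀ x, ‖φ x‖ ≤ C := hc.exists_bound_of_continuous hφc
  obtain ⟨C, hC⟩ := hbd
  have i1 : Integrable fun x => φ x • u x := hu.bdd_smul C hφc.aestronglyMeasurable (ae_of_all _ hC)
  have i2 : Integrable fun x => φ x • segInt e S b x :=
    hI.bdd_smul C hφc.aestronglyMeasurable (ae_of_all _ hC)
  -- The test function is the primitive of `φ`: its derivative along `e` is `φ (x + S e) - φ x`.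
  have key := h (segPotential e S φ) (contDiff_segPotential e S hφ hc)
    (hasCompactSupport_segPotential e S hc) (by
      refine (tsupport_segPotential_subset e S hc).trans ?_
      rintro _ ⟨⟨k, s⟩, ⟨hk, hs⟩, rfl⟩
      exact hΩe _ (hsupp hk).1 s hs.1)
  have e1 : (∫ x, (fderiv ℝ (segPotential e S φ) x e) • u x) = -∫ x, φ x • u x := by
    rw [← integral_neg]
    refine integral_congr_ae (ae_of_all _ fun x => ?_)
    simp only [fderiv_segPotential e hS0 hφ hc]
    by_cases hx : R ≤ ‖x‖
    · simp [hu0 x hx]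
    -- `S ≥ R + R₁` is needed here: from inside the ball of radius `R`, a shift by `S` leaves the
    -- ball of radius `R₁` that contains the support of `φ`.
    · have : φ (x + S • e) = 0 := by
        by_contra h0
        have h1 := (hsupp (subset_tsupport _ h0)).2
        rw [mem_ball_zero_iff] at h1
        have h2 : ‖S • e‖ ≤ ‖x + S • e‖ + ‖x‖ := by
          have := norm_sub_le (x + S • e) x
          simpa using this
        rw [norm_smul, he, Real.norm_of_nonneg hS0] at h2
        linarith
      rw [this]; simp
  have e2 : (∫ x, segPotential e S φ x • b x) = ∫ x, φ x • segInt e S b x := by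
    set ν := (volume : Measure ℝ).restrict (Set.Ioc 0 S)
    have j1 : Integrable (fun p : ℝ × E3 => φ (p.2 + p.1 • e) • b p.2) (ν.prod volume) := by
      refine (hb.comp_snd ν).bdd_smul C ?_ (ae_of_all _ fun p => hC _)
      have : Continuous fun p : ℝ × E3 => φ (p.2 + p.1 • e) := by fun_prop
      exact this.aestronglyMeasurable
    have j2 : Integrable (fun p : ℝ × E3 => φ p.2 • b (p.2 - p.1 • e)) (ν.prod volume) := by
      refine (integrable_shear e ν hb).bdd_smul C ?_ (ae_of_all _ fun p => hC _)
      have : Continuous fun p : ℝ × E3 => φ p.2 := by fun_prop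
      exact this.aestronglyMeasurable
    calc (∫ x, segPotential e S φ x • b x)
        = ∫ x, ∫ s, φ (x + s • e) • b x ∂ν := by
          refine integral_congr_ae (ae_of_all _ fun x => ?_)
          simp only [segPotential]
          rw [integral_smul_const]
      _ = ∫ s, (∫ x, φ (x + s • e) • b x) ∂ν := by
          rw [integral_integral_swap]
          exact j1.swap
      _ = ∫ s, (∫ x, φ x • b (x - s • e)) ∂ν := by
          refine integral_congr_ae (ae_of_all _ fun s => ?_)
          simp only
          rw [← integral_sub_right_eq_self (fun x => φ (x + s • e) • b x) (s • e)]
          simp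
      _ = ∫ x, ∫ s, φ x • b (x - s • e) ∂ν := by
          rw [integral_integral_swap]
          exact j2
      _ = _ := by
          refine integral_congr_ae (ae_of_all _ fun x => ?_)
          simp only [segInt]
          rw [integral_smul]
  simp only [smul_sub]
  rw [integral_sub i1 i2, ← e2, ← neg_eq_iff_eq_neg.2 key, e1]
  simp

/-- Fubini's theorem for the product of two ray integrals. -/
theorem integral_mul_segInt_add (e : E3) (S : ℝ) {a b : E3 → ℂ} (ha : MemLp a 2)
    (hb : MemLp b 2) :
    ∫ x, (a x * segInt e S b x + segInt e S a x * b x) =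
      ∫ x, a x * (segInt e S b x + segInt (-e) S b x) := by
  set ν := (volume : Measure ℝ).restrict (Set.Ioc 0 S) with hν
  have j1 := integrable_mul_shear e ν ha hb
  have j2 := integrable_mul_shear (-e) ν ha hb
  have j3 := integrable_mul_shear e ν hb ha
  have k1 : Integrable fun x => a x * segInt e S b x := by
    have := j1.integral_prod_right
    simpa only [integral_const_mul, segInt] using this
  have k2 : Integrable fun x => a x * segInt (-e) S b x := by
    have := j2.integral_prod_right
    simpa only [integral_const_mul, segInt] using this
  have k3 : Integrable fun x => segInt e S a x * b x := by
    have := j3.integral_prod_right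
    simpa only [integral_const_mul, mul_comm, segInt] using this
  simp only [mul_add]
  rw [integral_add k1 k3, integral_add k1 k2]
  congr 1
  -- Translating the variable moves the ray integral from `a` to `b` and reverses its direction.
  calc (∫ x, segInt e S a x * b x) = ∫ x, ∫ s, b x * a (x - s • e) ∂ν := by
        refine integral_congr_ae (ae_of_all _ fun x => ?_)
        simp only [segInt]
        rw [integral_const_mul, mul_comm]
    _ = ∫ s, (∫ x, b x * a (x - s • e)) ∂ν := by
        rw [integral_integral_swap]; exact j3.swap
    _ = ∫ s, (∫ x, a x * b (x - s • (-e))) ∂ν := by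
        refine integral_congr_ae (ae_of_all _ fun s => ?_)
        simp only
        rw [← integral_add_right_eq_self (fun x => b x * a (x - s • e)) (s • e)]
        simp [mul_comm]
    _ = ∫ x, ∫ s, a x * b (x - s • (-e)) ∂ν := by
        rw [integral_integral_swap]; exact j2
    _ = _ := by
        refine integral_congr_ae (ae_of_all _ fun x => ?_)
        simp only [segInt]
        rw [integral_const_mul]

theorem integrable_of_memLp_two_of_bounded {X : Type*} [MeasurableSpace X] [PseudoMetricSpace X]
    {μ : Measure X} [IsFiniteMeasureOnCompacts μ] [ProperSpace X] [OpensMeasurableSpace X]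
    {f : X → ℂ} (hf : MemLp f 2 μ) (x₀ : X) {R : ℝ} (h0 : ∀ x, R ≤ dist x x₀ → f x = 0) :
    Integrable f μ := by
  have : IsFiniteMeasure (μ.restrict (Metric.ball x₀ R)) :=
    ⟨by simpa using Metric.isBounded_ball.measure_lt_top⟩
  have h1 : IntegrableOn f (Metric.ball x₀ R) μ :=
    (hf.mono_measure Measure.restrict_le_self).integrable (by norm_num)
  refine (integrableOn_iff_integrable_of_support_subset ?_).1 h1
  intro x hx
  by_contra h
  exact hx (h0 x (by simpa using h))

/-! ### Integration by parts on a domain invariant along a direction. -/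

/-- Integration by parts without boundary term, for functions of bounded support on an open set
invariant under translations in the direction `e`. -/
theorem integral_mul_add_eq_zero {Ω : Set E3} (hΩ : IsOpen Ω) {e : E3} (he : ‖e‖ = 1)
    (hΩe : ∀ x ∈ Ω, ∀ s : ℝ, x - s • e ∈ Ω) {p a w b : E3 → ℂ} (hp : MemLp p 2) (ha : MemLp a 2)
    (hw : MemLp w 2) (hb : MemLp b 2) (hpa : WeakDerivOn Ω e p a) (hwb : WeakDerivOn Ω e w b)
    {R : ℝ} (hR : 0 ≤ R)
    (hp0 : ∀ x, R ≤ ‖x‖ → p x = 0) (ha0 : ∀ x, R ≤ ‖x‖ → a x = 0)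
    (hw0 : ∀ x, R ≤ ‖x‖ → w x = 0) (hb0 : ∀ x, R ≤ ‖x‖ → b x = 0)
    (haΩ : ∀ x, x ∉ Ω → a x = 0) (hbΩ : ∀ x, x ∉ Ω → b x = 0) :
    ∫ x, (a x * w x + p x * b x) = 0 := by
  have I : ∀ {f : E3 → ℂ}, MemLp f 2 → (∀ x, R ≤ ‖x‖ → f x = 0) → Integrable f := fun hf h0 =>
    integrable_of_memLp_two_of_bounded hf 0 (by simpa using h0)
  have hS : R + R ≤ 2 * R := by linarith
  have r1 := hpa.ae_eq_segInt hΩ he (fun x hx s _ => hΩe x hx s) (I hp hp0) (I ha ha0) hR hR hS hp0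
  have r2 := hwb.ae_eq_segInt hΩ he (fun x hx s _ => hΩe x hx s) (I hw hw0) (I hb hb0) hR hR hS hw0
  -- Invariance in both directions allows the opposite ray too: `w = -segInt (-e) b`, so the
  -- integral of `b` over the whole line is `w - w = 0`.
  have r3 := hwb.neg_dir.ae_eq_segInt hΩ (by simpa using he)
    (fun x hx s _ => by simpa using hΩe x hx (-s)) (I hw hw0) (I hb hb0).neg hR hR hS hw0
  calc ∫ x, (a x * w x + p x * b x)
      = ∫ x, (a x * segInt e (2 * R) b x + segInt e (2 * R) a x * b x) := by
        refine integral_congr_ae ?_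
        filter_upwards [r1, r2] with x h1 h2
        by_cases hx : x ∈ Ω ∩ Metric.ball 0 R
        · rw [h1 hx, h2 hx]
        · have : a x = 0 ∧ b x = 0 := by
            by_cases hxΩ : x ∈ Ω
            · have : R ≤ ‖x‖ := by
                by_contra hlt
                exact hx ⟨hxΩ, by simpa using hlt⟩
              exact ⟨ha0 x this, hb0 x this⟩
            · exact ⟨haΩ x hxΩ, hbΩ x hxΩ⟩
          simp [this]
    _ = ∫ x, a x * (segInt e (2 * R) b x + segInt (-e) (2 * R) b x) :=
        integral_mul_segInt_add e _ ha hb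
    _ = ∫ x, (0 : ℂ) := by
        refine integral_congr_ae ?_
        filter_upwards [r2, r3] with x h2 h3
        by_cases hx : x ∈ Ω ∩ Metric.ball 0 R
        · rw [← h2 hx]
          have : segInt (-e) (2 * R) b x = -w x := by
            rw [h3 hx]; simp [segInt, integral_neg]
          rw [this]; simp
        · have : a x = 0 := by
            by_cases hxΩ : x ∈ Ω
            · refine ha0 x ?_
              by_contra hlt
              exact hx ⟨hxΩ, by simpa using hlt⟩
            · exact haΩ x hxΩ
          simp [this]
    _ = 0 := by simp

/-! ### Coordinates of the half space and horizontal slices. -/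

theorem pt_two (y : E2) (t : ℝ) : pt y t 2 = t := rfl

/-- The coordinates `(y, t) ↦ (y₁, y₂, t)` of space. -/
def ptEquiv : E2 × ℝ ≃ᵐ E3 where
  toFun p := pt p.1 p.2
  invFun x := (!₂[x 0, x 1], x 2)
  left_inv p := by
    refine Prod.ext ?_ rfl
    ext i; fin_cases i <;> rfl
  right_inv x := by
    ext i; fin_cases i <;> rfl
  measurable_toFun := by
    have : Continuous fun p : E2 × ℝ => pt p.1 p.2 := by
      unfold pt
      refine (PiLp.continuous_toLp 2 _).comp (continuous_pi fun i => ?_)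
      fin_cases i <;> simp <;> fun_prop
    exact this.measurable
  measurable_invFun := by
    have : Continuous fun x : E3 => ((!₂[x 0, x 1] : E2), x 2) := by
      refine Continuous.prodMk ((PiLp.continuous_toLp 2 _).comp (continuous_pi fun i => ?_))
        (by fun_prop)
      fin_cases i <;> simp <;> fun_prop
    exact this.measurable

theorem continuous_pt : Continuous fun p : E2 × ℝ => pt p.1 p.2 := by
  unfold pt
  refine (PiLp.continuous_toLp 2 _).comp (continuous_pi fun i => ?_)
  fin_cases i <;> simp <;> fun_prop

theorem measurePreserving_ptEquiv : MeasurePreserving ptEquiv := by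
  have h1 : MeasurePreserving (fun x : E3 => (WithLp.ofLp x : Fin 3 → ℝ)) :=
    EuclideanSpace.volume_preserving_symm_measurableEquiv_toLp (Fin 3)
  have h2 := volume_preserving_piFinSuccAbove (fun _ : Fin 3 => ℝ) 2
  have h3 : MeasurePreserving (Prod.swap : ℝ × (Fin 2 → ℝ) → _) := Measure.measurePreserving_swap
  have h4 : MeasurePreserving (Prod.map (WithLp.toLp 2) id : (Fin 2 → ℝ) × ℝ → E2 × ℝ) :=
    (PiLp.volume_preserving_toLp (Fin 2)).prod (MeasurePreserving.id volume)
  have h5 := h4.comp (h3.comp (h2.comp h1))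
  have h6 : MeasurePreserving ptEquiv.symm := by
    convert h5 using 1
    funext x
    refine Prod.ext ?_ rfl
    ext i; fin_cases i <;> rfl
  exact h6.symm

theorem integral_eq_integral_pt {f : E3 → ℂ} (hf : Integrable f) :
    ∫ x, f x = ∫ y : E2, ∫ t : ℝ, f (pt y t) := by
  rw [← measurePreserving_ptEquiv.integral_comp']
  exact integral_prod _ ((measurePreserving_ptEquiv.integrable_comp_emb
    ptEquiv.measurableEmbedding).2 hf)

theorem pt_sub_smul (y : E2) (t s : ℝ) :
    pt y t - s • EuclideanSpace.single (2 : Fin 3) (1 : ℝ) = pt y (t - s) := by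
  ext i; fin_cases i <;> simp [pt]

theorem abs_le_norm_pt (y : E2) (t : ℝ) : |t| ≤ ‖pt y t‖ := by
  simpa [pt_two] using PiLp.norm_apply_le (pt y t) 2

theorem norm_pt_sq (y : E2) (t : ℝ) : ‖pt y t‖ ^ 2 = ‖y‖ ^ 2 + t ^ 2 := by
  simp [EuclideanSpace.norm_sq_eq, Fin.sum_univ_succ, pt]
  ring

theorem norm_pt_le (y : E2) (t : ℝ) : ‖pt y t‖ ≤ ‖y‖ + |t| := by
  refine abs_le_of_sq_le_sq' ?_ (by positivity) |>.2
  rw [norm_pt_sq]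
  nlinarith [norm_nonneg y, abs_nonneg t, sq_abs t]

theorem norm_le_norm_pt (y : E2) (t : ℝ) : ‖y‖ ≤ ‖pt y t‖ := by
  refine abs_le_of_sq_le_sq' ?_ (by positivity) |>.2
  rw [norm_pt_sq]
  nlinarith [sq_nonneg t]

theorem isOpen_lowerHalf : IsOpen lowerHalf :=
  isOpen_lt (by fun_prop) continuous_const

theorem measurableSet_lowerHalf : MeasurableSet lowerHalf := isOpen_lowerHalf.measurableSet

theorem ae_volH_iff {P : E3 → Prop} : (∀ᵐ x ∂volH, P x) ↔ ∀ᵐ x, x ∈ lowerHalf → P x :=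
  ae_restrict_iff' measurableSet_lowerHalf

/-- The coordinates `(t, y) ↦ (y₁, y₂, -t)`. -/
theorem measurePreserving_pt_neg :
    MeasurePreserving (fun p : ℝ × E2 => pt p.2 (-p.1)) (volume.prod volume) volume := by
  have h1 : MeasurePreserving (Prod.swap : ℝ × E2 → E2 × ℝ) := Measure.measurePreserving_swap
  have h2 : MeasurePreserving (Prod.map (fun y : E2 => y) (fun t : ℝ => -t)) :=
    (MeasurePreserving.id volume).prod (Measure.measurePreserving_neg volume)
  exact measurePreserving_ptEquiv.comp (h2.comp h1)

theorem ae_slice {P : E3 → Prop} (h : ∀ᵐ x ∂volH, P x) :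
    ∀ᵐ t : ℝ, 0 < t → ∀ᵐ y : E2, P (pt y (-t)) := by
  have h1 := measurePreserving_pt_neg.quasiMeasurePreserving.ae (ae_volH_iff.1 h)
  filter_upwards [Measure.ae_ae_of_ae_prod h1] with t ht ht0
  filter_upwards [ht] with y hy
  exact hy (by simpa [lowerHalf, pt_two] using ht0)

theorem eventually_slice {P : E3 → Prop} (h : ∀ᵐ x ∂volH, P x) :
    ∀ᶠ t in 𝓝[>] (0 : ℝ) ⊓ ae volume, ∀ᵐ y : E2, P (pt y (-t)) := by
  have h1 : ∀ᶠ t in 𝓝[>] (0 : ℝ) ⊓ ae volume, 0 < t :=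
    (eventually_nhdsWithin_of_forall fun t ht => ht).filter_mono inf_le_left
  filter_upwards [(ae_slice h).filter_mono inf_le_right, h1] with t h2 h3 using h2 h3

/-- Every interval `(0, ε)` has positive measure, hence meets every set of full measure. Uniqueness
of traces depends on this. -/
instance neBot_trace_filter : (𝓝[>] (0 : ℝ) ⊓ ae volume).NeBot := by
  rw [inf_neBot_iff]
  intro s hs s' hs'
  obtain ⟨ε, hε, hsub⟩ := (mem_nhdsGT_iff_exists_Ioo_subset).1 hs
  by_contra hne
  rw [Set.not_nonempty_iff_eq_empty] at hne
  have : Set.Ioo 0 ε ⊆ s'ᶜ := fun t ht hts => by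
    have : t ∈ s ∩ s' := ⟨hsub ht, hts⟩
    rw [hne] at this; exact this
  have h0 : volume (Set.Ioo 0 ε) = 0 := measure_mono_null this hs'
  rw [Real.volume_Ioo] at h0
  simp at h0
  exact absurd hε (not_lt.2 h0)

/-! ### Vertical line integrals as boundary values. -/

/-- The integral over a strip of lines is controlled in `L²`. -/
theorem eLpNorm_setIntegral_pt_le {b : E3 → ℂ} (hb : AEStronglyMeasurable b volume) (c d : ℝ) :
    eLpNorm (fun y : E2 => ∫ s in Set.Ioc c d, b (pt y s)) 2 volume ≤
      ENNReal.ofReal (d - c) ^ (1 / 2 : ℝ) * eLpNorm b 2 volume := by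
  have hbp : AEStronglyMeasurable (fun p : E2 × ℝ => b (pt p.1 p.2)) (volume.prod volume) :=
    hb.comp_measurePreserving measurePreserving_ptEquiv
  set ν := (volume : Measure ℝ).restrict (Set.Ioc c d)
  have hle : (volume : Measure E2).prod ν ≤ volume.prod volume := by
    have : (volume : Measure E2).prod ν =
        ((volume : Measure E2).prod (volume : Measure ℝ)).restrict (Set.univ ×ˢ Set.Ioc c d) := by
      rw [← Measure.prod_restrict, Measure.restrict_univ]
    rw [this]
    exact Measure.restrict_le_self
  have hbν := hbp.mono_measure hle
  have hslice : ∀ᵐ y : E2, AEStronglyMeasurable (fun s => b (pt y s)) ν := hbν.prodMk_left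
  have hpt : ∀ᵐ y : E2, ‖∫ s, b (pt y s) ∂ν‖ₑ ^ (2 : ℝ) ≤
      ENNReal.ofReal (d - c) * ∫⁻ s, ‖b (pt y s)‖ₑ ^ (2 : ℝ) ∂ν := by
    filter_upwards [hslice] with y hy
    have h1 : ‖∫ s, b (pt y s) ∂ν‖ₑ ≤ eLpNorm (fun s => b (pt y s)) 1 ν := by
      rw [eLpNorm_one_eq_lintegral_enorm]
      exact enorm_integral_le_lintegral_enorm _
    -- Cauchy–Schwarz on a segment of length `d - c`; this yields the factor `√t` in the convergence
    -- to the trace.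
    have h2 := eLpNorm_le_eLpNorm_mul_rpow_measure_univ (p := 1) (q := 2) (by norm_num) hy
    have h3 : ν Set.univ = ENNReal.ofReal (d - c) := by simp [ν]
    rw [h3, eLpNorm_eq_lintegral_rpow_enorm_toReal (p := 2) (by norm_num) (by norm_num)] at h2
    have h4 := ENNReal.rpow_le_rpow (h1.trans h2) (z := 2) (by norm_num)
    refine h4.trans ?_
    rw [ENNReal.mul_rpow_of_nonneg _ _ (by norm_num), ← ENNReal.rpow_mul, ← ENNReal.rpow_mul]
    norm_num
    rw [mul_comm]
  rw [eLpNorm_eq_lintegral_rpow_enorm_toReal (p := 2) (by norm_num) (by norm_num),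
    eLpNorm_eq_lintegral_rpow_enorm_toReal (p := 2) (by norm_num) (by norm_num)]
  simp only [ENNReal.toReal_ofNat]
  rw [← ENNReal.mul_rpow_of_nonneg _ _ (by norm_num)]
  refine ENNReal.rpow_le_rpow ?_ (by norm_num)
  calc ∫⁻ y : E2, ‖∫ s, b (pt y s) ∂ν‖ₑ ^ (2 : ℝ)
      ≤ ∫⁻ y : E2, ENNReal.ofReal (d - c) * ∫⁻ s, ‖b (pt y s)‖ₑ ^ (2 : ℝ) ∂ν :=
        lintegral_mono_ae hpt
    _ = ENNReal.ofReal (d - c) * ∫⁻ y : E2, ∫⁻ s, ‖b (pt y s)‖ₑ ^ (2 : ℝ) ∂ν :=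
        lintegral_const_mul' _ _ (by simp)
    _ = ENNReal.ofReal (d - c) *
          ∫⁻ p, ‖b (pt p.1 p.2)‖ₑ ^ (2 : ℝ) ∂((volume : Measure E2).prod ν) := by
        rw [lintegral_prod _ (hbν.enorm.pow_const _)]
    _ ≤ ENNReal.ofReal (d - c) *
          ∫⁻ p, ‖b (pt p.1 p.2)‖ₑ ^ (2 : ℝ) ∂((volume : Measure E2).prod volume) := by
        gcongr
    _ = ENNReal.ofReal (d - c) * ∫⁻ x, ‖b x‖ₑ ^ (2 : ℝ) := by
        congr 1
        exact measurePreserving_ptEquiv.lintegral_comp_emb ptEquiv.measurableEmbedding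
          (fun x => ‖b x‖ₑ ^ (2 : ℝ))

theorem aestronglyMeasurable_setIntegral_pt {b : E3 → ℂ} (hb : AEStronglyMeasurable b volume)
    (ν : Measure ℝ) [SFinite ν] (hν : ν ≪ volume) :
    AEStronglyMeasurable (fun y : E2 => ∫ s, b (pt y s) ∂ν) volume := by
  have hbp : AEStronglyMeasurable (fun p : E2 × ℝ => b (pt p.1 p.2)) (volume.prod volume) :=
    hb.comp_measurePreserving measurePreserving_ptEquiv
  exact (hbp.mono_ac (Measure.AbsolutelyContinuous.rfl.prod hν)).integral_prod_right'

/-- The integral of `b` over vertical lines. -/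
def lineTrace (b : E3 → ℂ) (y : E2) : ℂ := ∫ s, b (pt y s)

theorem lineTrace_eq_interval {b : E3 → ℂ} {R : ℝ} (hb0 : ∀ x, R ≤ ‖x‖ → b x = 0) {c d : ℝ}
    (hc : c ≤ -R) (hd : R ≤ d) (hR : 0 ≤ R) (y : E2) :
    lineTrace b y = ∫ s in c..d, b (pt y s) := by
  rw [lineTrace, intervalIntegral.integral_of_le (by linarith)]
  symm
  refine setIntegral_eq_integral_of_forall_compl_eq_zero fun s hs => hb0 _ ?_
  refine le_trans ?_ (abs_le_norm_pt y s)
  by_contra hlt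
  rw [not_le, abs_lt] at hlt
  exact hs ⟨by linarith, by linarith⟩

theorem ae_integrable_line {b : E3 → ℂ} (hb : Integrable b) :
    ∀ᵐ y : E2, Integrable fun s => b (pt y s) :=
  Integrable.prod_right_ae ((measurePreserving_ptEquiv.integrable_comp_emb
    ptEquiv.measurableEmbedding).2 hb)

theorem segInt_pt {b : E3 → ℂ} {S : ℝ} (hS : 0 ≤ S) (y : E2) (t : ℝ) :
    segInt (EuclideanSpace.single 2 1) S b (pt y t) = ∫ s in (t - S)..t, b (pt y s) := by
  simp only [segInt, pt_sub_smul]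
  rw [← intervalIntegral.integral_of_le hS,
    intervalIntegral.integral_comp_sub_left (fun s => b (pt y s))]
  simp

theorem segInt_neg_pt {b : E3 → ℂ} {S : ℝ} (hS : 0 ≤ S) (y : E2) (t : ℝ) :
    segInt (-EuclideanSpace.single 2 1) S b (pt y t) = ∫ s in t..(t + S), b (pt y s) := by
  have : ∀ s : ℝ, pt y t - s • -EuclideanSpace.single (2 : Fin 3) (1 : ℝ) = pt y (t + s) := by
    intro s
    have := pt_sub_smul y t (-s)
    simpa using this
  simp only [segInt, this]
  rw [← intervalIntegral.integral_of_le hS,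
    intervalIntegral.integral_comp_add_left (fun s => b (pt y s))]
  simp

theorem sub_smul_mem_lowerHalf (x : E3) (hx : x ∈ lowerHalf) (s : ℝ) (hs : 0 ≤ s) :
    x - s • EuclideanSpace.single (2 : Fin 3) (1 : ℝ) ∈ lowerHalf := by
  simp only [lowerHalf, Set.mem_ofPred_eq] at *
  simp; linarith

theorem memLp_lineTrace {b : E3 → ℂ} (hb : MemLp b 2) {R : ℝ} (hR : 0 ≤ R)
    (hb0 : ∀ x, R ≤ ‖x‖ → b x = 0) : MemLp (lineTrace b) 2 := by
  have : lineTrace b = fun y => ∫ s in Set.Ioc (-R) R, b (pt y s) := by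
    ext y
    rw [lineTrace_eq_interval hb0 le_rfl le_rfl hR, intervalIntegral.integral_of_le (by linarith)]
  rw [this]
  refine ⟨aestronglyMeasurable_setIntegral_pt hb.1 _ Measure.restrict_le_self.absolutelyContinuous,
    (eLpNorm_setIntegral_pt_le hb.1 _ _).trans_lt ?_⟩
  exact ENNReal.mul_lt_top (ENNReal.rpow_lt_top_of_nonneg (by norm_num) (by simp)) hb.2

/-- The trace of a function of bounded support is the integral of its vertical derivative. -/
theorem isTrace_lineTrace {u b : E3 → ℂ} (h : WeakDerivOn lowerHalf (EuclideanSpace.single 2 1) u b)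
    (hu : Integrable u) (hb : MemLp b 2) {R : ℝ} (hR : 0 ≤ R) (hu0 : ∀ x, R ≤ ‖x‖ → u x = 0)
    (hb0 : ∀ x, R ≤ ‖x‖ → b x = 0) (hbH : ∀ x, x ∉ lowerHalf → b x = 0) :
    IsTrace u (lineTrace b) := by
  intro R'
  refine ⟨(memLp_lineTrace hb hR hb0).mono_measure Measure.restrict_le_self, ?_⟩
  have hbI : Integrable b := integrable_of_memLp_two_of_bounded hb 0 (by simpa using hb0)
  set R₁ := |R'| + 1 with hR₁
  have ray := h.ae_eq_segInt isOpen_lowerHalf (by simp) sub_smul_mem_lowerHalf hu hbI hR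
    (R₁ := R₁) (by positivity) le_rfl hu0
  have hS : 0 ≤ R + R₁ := by positivity
  have key : ∀ᶠ t in 𝓝[>] (0 : ℝ) ⊓ ae volume,
      eLpNorm (fun y => u (pt y (-t)) - lineTrace b y) 2 (volume.restrict (Metric.ball 0 R')) ≤
        ENNReal.ofReal t ^ (1 / 2 : ℝ) * eLpNorm b 2 volume := by
    have ht1 : ∀ᶠ t in 𝓝[>] (0 : ℝ) ⊓ ae volume, t ∈ Set.Ioo (0 : ℝ) 1 :=
      Eventually.filter_mono inf_le_left (Ioo_mem_nhdsGT one_pos)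
    have hray : ∀ᵐ x ∂volH, x ∈ Metric.ball (0 : E3) R₁ →
        u x = segInt (EuclideanSpace.single 2 1) (R + R₁) b x := by
      rw [ae_volH_iff]
      filter_upwards [ray] with x hx h1 h2 using hx ⟨h1, h2⟩
    filter_upwards [ht1, eventually_slice hray] with t ht hsl
    have e1 : eLpNorm (fun y => u (pt y (-t)) - lineTrace b y) 2
        (volume.restrict (Metric.ball 0 R')) ≤
        eLpNorm (fun y => ∫ s in Set.Ioc (-t) 0, b (pt y s)) 2 volume := by
      refine le_trans ?_ (eLpNorm_mono_measure _ (Measure.restrict_le_self (s := Metric.ball 0 R')))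
      refine eLpNorm_mono_ae ?_
      filter_upwards [ae_restrict_of_ae hsl, ae_restrict_of_ae (ae_integrable_line hbI),
        ae_restrict_mem measurableSet_ball] with y hy hyI hyb
      have hyb' : ‖y‖ < R' := by simpa using hyb
      have hm : pt y (-t) ∈ Metric.ball (0 : E3) R₁ := by
        rw [mem_ball_zero_iff]
        refine (norm_pt_le _ _).trans_lt ?_
        rw [abs_neg, abs_of_pos ht.1]
        have := le_abs_self R'
        linarith [ht.2]
      -- The lower limit `-t - (R + R₁)` is already below the support of `b`, so `u (pt y (-t))` is
      -- the part of the line integral below height `-t`. The rest is the integral over `(-t, 0]`,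
      -- as `b` vanishes above the boundary.
      rw [hy hm, segInt_pt hS, lineTrace_eq_interval hb0 (c := -t - (R + R₁)) (d := R)
        (by linarith [ht.1, abs_nonneg R']) le_rfl hR]
      have hz : ∫ s in (0 : ℝ)..R, b (pt y s) = 0 := by
        rw [intervalIntegral.integral_of_le hR]
        refine setIntegral_eq_zero_of_forall_eq_zero fun s hs => hbH _ ?_
        simpa [lowerHalf, pt_two] using hs.1.le
      rw [← intervalIntegral.integral_add_adjacent_intervals (b := -t) (c := R)
          hyI.intervalIntegrable hyI.intervalIntegrable,
        ← intervalIntegral.integral_add_adjacent_intervals (a := -t) (b := 0)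
          hyI.intervalIntegrable hyI.intervalIntegrable, hz,
        intervalIntegral.integral_of_le (by linarith [ht.1] : -t ≤ 0)]
      refine le_of_eq ?_
      rw [← norm_neg]
      congr 1
      ring
    refine e1.trans ?_
    simpa using eLpNorm_setIntegral_pt_le hb.1 (-t) 0
  refine tendsto_of_tendsto_of_tendsto_of_le_of_le' tendsto_const_nhds ?_
    (Eventually.of_forall fun _ => zero_le) key
  have h1 : Tendsto (fun t : ℝ => ENNReal.ofReal t ^ (1 / 2 : ℝ)) (𝓝 0) (𝓝 0) := by
    have h2 : Continuous fun t : ℝ => ENNReal.ofReal t ^ (1 / 2 : ℝ) :=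
      ENNReal.continuous_rpow_const.comp ENNReal.continuous_ofReal
    simpa using h2.tendsto 0
  have h3 := ENNReal.Tendsto.mul_const h1 (Or.inr hb.2.ne)
  rw [zero_mul] at h3
  exact h3.mono_left (inf_le_left.trans nhdsWithin_le_nhds)

/-- Integration by parts in the vertical direction for functions of bounded support. -/
theorem integral_mul_add_eq_lineTrace {p a w b : E3 → ℂ} (hp : MemLp p 2) (ha : MemLp a 2)
    (hw : MemLp w 2) (hb : MemLp b 2)
    (hpa : WeakDerivOn lowerHalf (EuclideanSpace.single 2 1) p a)
    (hwb : WeakDerivOn lowerHalf (EuclideanSpace.single 2 1) w b) {R : ℝ} (hR : 0 ≤ R)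
    (hp0 : ∀ x, R ≤ ‖x‖ → p x = 0) (ha0 : ∀ x, R ≤ ‖x‖ → a x = 0)
    (hw0 : ∀ x, R ≤ ‖x‖ → w x = 0) (hb0 : ∀ x, R ≤ ‖x‖ → b x = 0)
    (haH : ∀ x, x ∉ lowerHalf → a x = 0) (hbH : ∀ x, x ∉ lowerHalf → b x = 0) :
    ∫ x, (a x * w x + p x * b x) = ∫ y, lineTrace a y * lineTrace b y := by
  have I : ∀ {f : E3 → ℂ}, MemLp f 2 → (∀ x, R ≤ ‖x‖ → f x = 0) → Integrable f := fun hf h0 =>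
    integrable_of_memLp_two_of_bounded hf 0 (by simpa using h0)
  have hS : R + R ≤ 2 * R := by linarith
  have hS0 : 0 ≤ 2 * R := by linarith
  have r1 := hpa.ae_eq_segInt isOpen_lowerHalf (by simp) sub_smul_mem_lowerHalf
    (I hp hp0) (I ha ha0) hR hR hS hp0
  have r2 := hwb.ae_eq_segInt isOpen_lowerHalf (by simp) sub_smul_mem_lowerHalf
    (I hw hw0) (I hb hb0) hR hR hS hw0
  set e : E3 := EuclideanSpace.single 2 1 with he
  set ν := (volume : Measure ℝ).restrict (Set.Ioc 0 (2 * R)) with hν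
  have hint : Integrable fun x => a x * (segInt e (2 * R) b x + segInt (-e) (2 * R) b x) := by
    have j1 := (integrable_mul_shear e ν ha hb).integral_prod_right
    have j2 := (integrable_mul_shear (-e) ν ha hb).integral_prod_right
    simp only [integral_const_mul] at j1 j2
    refine (j1.add j2).congr (ae_of_all _ fun x => ?_)
    simp only [segInt, Pi.add_apply]
    ring
  calc ∫ x, (a x * w x + p x * b x)
      = ∫ x, (a x * segInt e (2 * R) b x + segInt e (2 * R) a x * b x) := by
        refine integral_congr_ae ?_
        filter_upwards [r1, r2] with x h1 h2
        by_cases hx : x ∈ lowerHalf ∩ Metric.ball 0 R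
        · rw [h1 hx, h2 hx]
        · have : a x = 0 ∧ b x = 0 := by
            by_cases hxΩ : x ∈ lowerHalf
            · have : R ≤ ‖x‖ := by
                by_contra hlt
                exact hx ⟨hxΩ, by simpa using hlt⟩
              exact ⟨ha0 x this, hb0 x this⟩
            · exact ⟨haH x hxΩ, hbH x hxΩ⟩
          simp [this]
    _ = ∫ x, a x * (segInt e (2 * R) b x + segInt (-e) (2 * R) b x) :=
        integral_mul_segInt_add e _ ha hb
    _ = ∫ y, ∫ t, a (pt y t) * (segInt e (2 * R) b (pt y t) + segInt (-e) (2 * R) b (pt y t)) :=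
        integral_eq_integral_pt hint
    _ = ∫ y, lineTrace a y * lineTrace b y := by
        refine integral_congr_ae ?_
        filter_upwards [ae_integrable_line (I hb hb0)] with y hy
        rw [lineTrace, ← integral_mul_const]
        refine integral_congr_ae (ae_of_all _ fun t => ?_)
        by_cases ht : R ≤ ‖pt y t‖
        · simp [ha0 _ ht]
        · beta_reduce
          -- The two opposite rays from height `t` join to the window `[t - 2R, t + 2R]`, which
          -- contains `[-R, R]` because `|t| < R`; their sum no longer depends on `t`.
          rw [he, segInt_pt hS0, segInt_neg_pt hS0,
            intervalIntegral.integral_add_adjacent_intervals hy.intervalIntegrable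
              hy.intervalIntegrable]
          have h1 := abs_le_norm_pt y t
          have h2 := abs_lt.1 (h1.trans_lt (not_le.1 ht))
          rw [lineTrace_eq_interval hb0 (c := t - 2 * R) (d := t + 2 * R) (by linarith)
            (by linarith) hR]

/-! ### Calculus of `L²_loc` functions and weak partial derivatives. -/

section

theorem isFiniteMeasure_ball (R : ℝ) :
    IsFiniteMeasure ((volume : Measure E3).restrict (Metric.ball 0 R)) :=
  ⟨by
    rw [Measure.restrict_apply_univ]
    exact measure_ball_lt_top⟩

theorem volH_restrict_ball (R : ℝ) :
    volH.restrict (Metric.ball 0 R) = volume.restrict (lowerHalf ∩ Metric.ball 0 R) := by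
  rw [volH, Measure.restrict_restrict measurableSet_ball, Set.inter_comm]

theorem memL2loc_iff {u : E3 → ℂ} :
    MemL2loc u ↔ ∀ R : ℝ, MemLp u 2 (volH.restrict (Metric.ball 0 R)) := by
  simp only [MemL2loc, volH_restrict_ball]

theorem MemL2loc.aestronglyMeasurable {u : E3 → ℂ} (hu : MemL2loc u) :
    AEStronglyMeasurable u volH := by
  rw [memL2loc_iff] at hu
  have h : AEStronglyMeasurable u (volH.restrict (⋃ n : ℕ, Metric.ball (0 : E3) n)) :=
    aestronglyMeasurable_iUnion_iff.2 fun n => (hu n).1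
  rwa [Metric.iUnion_ball_nat, Measure.restrict_univ] at h

theorem MemL2loc.congr {u v : E3 → ℂ} (hu : MemL2loc u) (h : u =ᵐ[volH] v) : MemL2loc v := by
  rw [memL2loc_iff] at *
  exact fun R => (memLp_congr_ae (ae_restrict_of_ae h)).1 (hu R)

theorem MemL2loc.add {u v : E3 → ℂ} (hu : MemL2loc u) (hv : MemL2loc v) :
    MemL2loc (fun x => u x + v x) := fun R => (hu R).add (hv R)

theorem MemL2loc.bdd_mul {c u : E3 → ℂ} (hu : MemL2loc u) (hc : AEStronglyMeasurable c volH)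
    (hb : ∀ R : ℝ, ∃ C, ∀ᵐ x ∂volH, x ∈ Metric.ball (0 : E3) R → ‖c x‖ ≤ C) :
    MemL2loc (fun x => c x * u x) := by
  rw [memL2loc_iff] at *
  intro R
  obtain ⟨C, hC⟩ := hb R
  refine (hu R).of_le_mul (c := C) ((hc.mono_measure Measure.restrict_le_self).mul (hu R).1) ?_
  filter_upwards [ae_restrict_of_ae hC, ae_restrict_mem measurableSet_ball] with x hx hm
  rw [norm_mul]
  exact mul_le_mul_of_nonneg_right (hx hm) (norm_nonneg _)

theorem exists_bound_ball {c : E3 → ℂ} (hc : Continuous c) (R : ℝ) :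
    ∃ C, 0 ≤ C ∧ ∀ x, x ∈ Metric.ball (0 : E3) R → ‖c x‖ ≤ C := by
  obtain ⟨C, hC⟩ := (isCompact_closedBall (0 : E3) R).exists_bound_of_continuousOn hc.continuousOn
  exact ⟨max C 0, le_max_right _ _, fun x hx =>
    (hC x (Metric.ball_subset_closedBall hx)).trans (le_max_left _ _)⟩

theorem MemL2loc.continuous_mul {c u : E3 → ℂ} (hu : MemL2loc u) (hc : Continuous c) :
    MemL2loc (fun x => c x * u x) :=
  hu.bdd_mul hc.aestronglyMeasurable fun R => by
    obtain ⟨C, -, hC⟩ := exists_bound_ball hc R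
    exact ⟨C, ae_of_all _ hC⟩

theorem MemL2loc.conj {u : E3 → ℂ} (hu : MemL2loc u) :
    MemL2loc (fun x => (starRingEnd ℂ) (u x)) := fun R => (hu R).star

theorem MemL2loc.integrableOn_ball {u : E3 → ℂ} (hu : MemL2loc u) (R : ℝ) :
    IntegrableOn (lowerHalf.indicator u) (Metric.ball 0 R) := by
  have := isFiniteMeasure_ball R
  have h : MemLp (lowerHalf.indicator u) 2 (volume.restrict (Metric.ball 0 R)) := by
    rw [memLp_indicator_iff_restrict measurableSet_lowerHalf,
      Measure.restrict_restrict measurableSet_lowerHalf]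
    exact hu R
  exact h.integrable (by norm_num)

theorem MemL2loc.locallyIntegrable {u : E3 → ℂ} (hu : MemL2loc u) :
    LocallyIntegrable (lowerHalf.indicator u) := by
  intro x
  refine ⟨Metric.ball 0 (‖x‖ + 1), Metric.isOpen_ball.mem_nhds (by simp), hu.integrableOn_ball _⟩

theorem MemL2loc.locallyIntegrableOn {u : E3 → ℂ} (hu : MemL2loc u) :
    LocallyIntegrableOn u lowerHalf := by
  rw [locallyIntegrableOn_iff isOpen_lowerHalf.isLocallyClosed]
  intro k hk hkc
  obtain ⟨R, hR⟩ := hkc.isBounded.subset_ball 0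
  have h := (hu.integrableOn_ball R).mono_set hR
  refine h.congr_fun_ae ?_
  filter_upwards [ae_restrict_mem hkc.measurableSet] with x hx
  simp [hk hx]

/-- `g` is the weak partial derivative `∂ⱼ u`, both functions being square integrable up to the
boundary. -/
structure HasL2Partial (j : Fin 3) (u g : E3 → ℂ) : Prop where
  memL2loc : MemL2loc u
  memL2loc_partial : MemL2loc g
  weakDerivOn : WeakDerivOn lowerHalf (EuclideanSpace.single j 1) (lowerHalf.indicator u)
    (lowerHalf.indicator g)

theorem smul_indicator_eq (s : Set E3) (φ : E3 → ℝ) (u : E3 → ℂ) :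
    (fun x => φ x • s.indicator u x) = s.indicator fun x => φ x • u x := by
  ext x
  by_cases hx : x ∈ s <;> simp [hx]

theorem integral_smul_indicator (φ : E3 → ℝ) (u : E3 → ℂ) :
    ∫ x, φ x • lowerHalf.indicator u x = ∫ x, φ x • u x ∂volH := by
  rw [smul_indicator_eq, integral_indicator measurableSet_lowerHalf, volH]

theorem HasWeakPartial.weakDerivOn {j : Fin 3} {u g : E3 → ℂ} (h : HasWeakPartial j u g) :
    WeakDerivOn lowerHalf (EuclideanSpace.single j 1) (lowerHalf.indicator u)
      (lowerHalf.indicator g) := by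
  intro φ h1 h2 h3
  rw [integral_smul_indicator, integral_smul_indicator]
  exact h.2.2 φ h1 h2 h3

theorem HasL2Partial.hasWeakPartial {j : Fin 3} {u g : E3 → ℂ} (h : HasL2Partial j u g) :
    HasWeakPartial j u g := by
  refine ⟨h.1.locallyIntegrableOn, h.2.locallyIntegrableOn, fun φ h1 h2 h3 => ?_⟩
  rw [← integral_smul_indicator, ← integral_smul_indicator]
  exact h.3 φ h1 h2 h3

theorem HasWeakPartial.unique {j : Fin 3} {u g g' : E3 → ℂ} (h : HasWeakPartial j u g)
    (h' : HasWeakPartial j u g') : g =ᵐ[volH] g' := by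
  suffices H : ∀ᵐ x, x ∈ lowerHalf → g x - g' x = 0 by
    refine ae_volH_iff.2 ?_
    filter_upwards [H] with x hx hm using sub_eq_zero.1 (hx hm)
  refine isOpen_lowerHalf.ae_eq_zero_of_integral_contDiff_smul_eq_zero (h.2.1.sub h'.2.1) ?_
  intro φ h1 h2 h3
  have I : ∀ {f : E3 → ℂ}, LocallyIntegrableOn f lowerHalf → Integrable (fun x => φ x • f x) := by
    intro f hf
    obtain ⟨C, hC⟩ := h2.exists_bound_of_continuous h1.continuous
    have hi : IntegrableOn (fun x => φ x • f x) (tsupport φ) :=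
      (hf.integrableOn_compact_subset h3 h2.isCompact).bdd_smul C
        h1.continuous.aestronglyMeasurable (ae_of_all _ hC)
    refine (integrableOn_iff_integrable_of_support_subset ?_).1 hi
    intro x hx
    refine subset_tsupport _ fun h0 => hx ?_
    simp [h0]
  have e := h.2.2 φ h1 h2 h3
  rw [h'.2.2 φ h1 h2 h3, neg_inj] at e
  have hz : ∀ f : E3 → ℂ, ∫ x, φ x • f x ∂volH = ∫ x, φ x • f x := by
    intro f
    rw [volH]
    refine setIntegral_eq_integral_of_forall_compl_eq_zero fun x hx => ?_
    have : φ x = 0 := image_eq_zero_of_notMem_tsupport fun h => hx (h3 h)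
    simp [this]
  rw [hz, hz] at e
  simp only [smul_sub]
  rw [integral_sub (I h.2.1) (I h'.2.1), e, sub_self]

/-- The derivative selected by choice in `weakPartial` can be exchanged for any explicit weak
derivative, up to null sets. -/
theorem HasWeakPartial.weakPartial_ae {j : Fin 3} {u g : E3 → ℂ} (h : HasWeakPartial j u g) :
    weakPartial j u =ᵐ[volH] g := by
  have hex : ∃ g, HasWeakPartial j u g := ⟨g, h⟩
  rw [weakPartial, dif_pos hex]
  exact hex.choose_spec.unique h

theorem indicator_ae_eq {u v : E3 → ℂ} (h : u =ᵐ[volH] v) :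
    lowerHalf.indicator u =ᵐ[volume] lowerHalf.indicator v := by
  filter_upwards [ae_volH_iff.1 h] with x hx
  by_cases hm : x ∈ lowerHalf
  · simp [hm, hx hm]
  · simp [hm]

theorem WeakDerivOn.congr {Ω : Set E3} {e : E3} {u g u' g' : E3 → ℂ} (h : WeakDerivOn Ω e u g)
    (hu : u =ᵐ[volume] u') (hg : g =ᵐ[volume] g') : WeakDerivOn Ω e u' g' := by
  intro φ h1 h2 h3
  have e1 : ∫ x, (fderiv ℝ φ x e) • u' x = ∫ x, (fderiv ℝ φ x e) • u x :=
    integral_congr_ae (by filter_upwards [hu] with x hx; rw [hx])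
  have e2 : ∫ x, φ x • g' x = ∫ x, φ x • g x :=
    integral_congr_ae (by filter_upwards [hg] with x hx; rw [hx])
  rw [e1, e2, h φ h1 h2 h3]

theorem HasL2Partial.congr {j : Fin 3} {u g u' g' : E3 → ℂ} (h : HasL2Partial j u g)
    (hu : u =ᵐ[volH] u') (hg : g =ᵐ[volH] g') : HasL2Partial j u' g' :=
  ⟨h.1.congr hu, h.2.congr hg, h.3.congr (indicator_ae_eq hu) (indicator_ae_eq hg)⟩

theorem MemH1loc.hasL2Partial {u : E3 → ℂ} (h : MemH1loc u) (j : Fin 3) :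
    HasL2Partial j u (weakPartial j u) := by
  obtain ⟨g, hg, hg2⟩ := h.2 j
  exact HasL2Partial.congr ⟨h.1, hg2, hg.weakDerivOn⟩ EventuallyEq.rfl hg.weakPartial_ae.symm

theorem memH1loc_of {u : E3 → ℂ} (h : ∀ j, ∃ g, HasL2Partial j u g) : MemH1loc u :=
  ⟨(h 0).choose_spec.1, fun j => (h j).imp fun _ hg => ⟨hg.hasWeakPartial, hg.2⟩⟩

theorem MemH1loc.congr {u u' : E3 → ℂ} (h : MemH1loc u) (hu : u =ᵐ[volH] u') : MemH1loc u' :=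
  memH1loc_of fun j => ⟨_, (h.hasL2Partial j).congr hu EventuallyEq.rfl⟩

theorem MemH2loc.memH1loc {u : E3 → ℂ} (h : MemH2loc u) : MemH1loc u :=
  ⟨h.1, fun j => (h.2 j).imp fun _ hg => ⟨hg.1, hg.2.1⟩⟩

theorem MemH2loc.memH1loc_weakPartial {u : E3 → ℂ} (h : MemH2loc u) (j : Fin 3) :
    MemH1loc (weakPartial j u) := by
  obtain ⟨g, hg, hg2⟩ := h.2 j
  exact hg2.congr hg.weakPartial_ae.symm

section algebra

variable {j : Fin 3} {u g v h : E3 → ℂ}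

theorem MemL2loc.integrable_smul (hu : MemL2loc u) {φ : E3 → ℝ} (hφ : Continuous φ)
    (hc : HasCompactSupport φ) : Integrable fun x => φ x • lowerHalf.indicator u x :=
  hu.locallyIntegrable.integrable_smul_left_of_hasCompactSupport hφ hc

theorem continuous_fderiv_apply {φ : E3 → ℝ} (h1 : ContDiff ℝ ∞ φ) (e : E3) :
    Continuous fun x => fderiv ℝ φ x e :=
  (h1.continuous_fderiv (by simp)).clm_apply continuous_const

theorem hasCompactSupport_fderiv_apply {φ : E3 → ℝ} (h2 : HasCompactSupport φ) (e : E3) :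
    HasCompactSupport fun x => fderiv ℝ φ x e :=
  (h2.fderiv ℝ).comp_left (g := fun L : E3 →L[ℝ] ℝ => L e) (by simp)

theorem HasL2Partial.add (hu : HasL2Partial j u g) (hv : HasL2Partial j v h) :
    HasL2Partial j (fun x => u x + v x) (fun x => g x + h x) := by
  refine ⟨hu.1.add hv.1, hu.2.add hv.2, fun φ h1 h2 h3 => ?_⟩
  have hi : ∀ f f' : E3 → ℂ, lowerHalf.indicator (fun x => f x + f' x) =
      fun x => lowerHalf.indicator f x + lowerHalf.indicator f' x := fun f f' =>
    Set.indicator_add _ _ _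
  simp only [hi, smul_add]
  rw [integral_add (hu.1.integrable_smul (continuous_fderiv_apply h1 _)
      (hasCompactSupport_fderiv_apply h2 _)) (hv.1.integrable_smul (continuous_fderiv_apply h1 _)
      (hasCompactSupport_fderiv_apply h2 _)),
    integral_add (hu.2.integrable_smul h1.continuous h2) (hv.2.integrable_smul h1.continuous h2),
    hu.3 φ h1 h2 h3, hv.3 φ h1 h2 h3]
  ring

theorem HasL2Partial.const_mul (hu : HasL2Partial j u g) (c : ℂ) :
    HasL2Partial j (fun x => c * u x) (fun x => c * g x) := by
  refine ⟨hu.1.continuous_mul continuous_const, hu.2.continuous_mul continuous_const,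
    fun φ h1 h2 h3 => ?_⟩
  have hi : ∀ f : E3 → ℂ, lowerHalf.indicator (fun x => c * f x) =
      fun x => c * lowerHalf.indicator f x := fun f => by
    ext x
    by_cases hx : x ∈ lowerHalf <;> simp [hx]
  have hs : ∀ (r : ℝ) (z : ℂ), r • (c * z) = c * r • z := fun r z =>
    (mul_smul_comm _ _ _).symm
  simp only [hi, hs, integral_const_mul]
  rw [hu.3 φ h1 h2 h3]
  ring

theorem HasL2Partial.conj (hu : HasL2Partial j u g) :
    HasL2Partial j (fun x => (starRingEnd ℂ) (u x)) (fun x => (starRingEnd ℂ) (g x)) := by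
  refine ⟨hu.1.conj, hu.2.conj, fun φ h1 h2 h3 => ?_⟩
  have hi : ∀ (r : ℝ) (f : E3 → ℂ) (x : E3),
      r • lowerHalf.indicator (fun x => (starRingEnd ℂ) (f x)) x =
      (starRingEnd ℂ) (r • lowerHalf.indicator f x) := by
    intro r f x
    by_cases hx : x ∈ lowerHalf <;> simp [hx]
  simp only [hi]
  rw [integral_conj, integral_conj, hu.3 φ h1 h2 h3, map_neg]

end algebra

/-! ### Leibniz rules for smooth and Lipschitz factors. -/

/-- Leibniz rule for the product with a smooth function. -/
theorem WeakDerivOn.smul {Ω Ω' : Set E3} {e : E3} {u g : E3 → ℂ} (h : WeakDerivOn Ω e u g)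
    (hu : LocallyIntegrable u) (hg : LocallyIntegrable g) {ψ : E3 → ℝ} (hψ : ContDiff ℝ ∞ ψ)
    (hΩ : Ω' ∩ tsupport ψ ⊆ Ω) :
    WeakDerivOn Ω' e (fun x => ψ x • u x) (fun x => ψ x • g x + fderiv ℝ ψ x e • u x) := by
  intro φ h1 h2 h3
  have key := h (fun x => φ x * ψ x) (h1.mul hψ) h2.mul_right (by
    intro x hx
    exact hΩ ⟨h3 (tsupport_mul_subset_left hx), tsupport_mul_subset_right hx⟩)
  have hd : ∀ x, fderiv ℝ (fun x => φ x * ψ x) x e =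
      φ x * fderiv ℝ ψ x e + ψ x * fderiv ℝ φ x e := by
    intro x
    rw [fderiv_fun_mul (h1.differentiable (by simp) x) (hψ.differentiable (by simp) x)]
    simp
  simp only [hd] at key
  have hφ' := continuous_fderiv_apply h1 e
  have hψ' := continuous_fderiv_apply hψ e
  have i1 : Integrable fun x => (φ x * fderiv ℝ ψ x e) • u x :=
    hu.integrable_smul_left_of_hasCompactSupport (h1.continuous.mul hψ') h2.mul_right
  have i2 : Integrable fun x => (ψ x * fderiv ℝ φ x e) • u x :=
    hu.integrable_smul_left_of_hasCompactSupport (hψ.continuous.mul hφ')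
      (hasCompactSupport_fderiv_apply h2 e).mul_left
  have i3 : Integrable fun x => (φ x * ψ x) • g x :=
    hg.integrable_smul_left_of_hasCompactSupport (h1.continuous.mul hψ.continuous) h2.mul_right
  simp only [add_smul] at key
  rw [integral_add i1 i2] at key
  have e1 : ∫ x, (fderiv ℝ φ x e) • ψ x • u x = ∫ x, (ψ x * fderiv ℝ φ x e) • u x := by
    refine integral_congr_ae (ae_of_all _ fun x => ?_)
    simp only [smul_smul, mul_comm]
  have e2 : ∫ x, φ x • (ψ x • g x + fderiv ℝ ψ x e • u x) =
      (∫ x, (φ x * ψ x) • g x) + ∫ x, (φ x * fderiv ℝ ψ x e) • u x := by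
    rw [← integral_add i3 i1]
    refine integral_congr_ae (ae_of_all _ fun x => ?_)
    simp only [smul_smul, smul_add]
  rw [e1, e2, ← sub_eq_iff_eq_add'.2 key.symm]
  ring

theorem indicator_leibniz (s : Set E3) (c d : E3 → ℝ) (u g : E3 → ℂ) :
    s.indicator (fun x => c x • g x + d x • u x) =
      fun x => c x • s.indicator g x + d x • s.indicator u x := by
  ext x
  by_cases hx : x ∈ s <;> simp [hx]

theorem memL2loc_smul {u : E3 → ℂ} (hu : MemL2loc u) {c : E3 → ℝ} (hc : Continuous c) :
    MemL2loc fun x => c x • u x := by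
  simp only [Complex.real_smul]
  exact hu.continuous_mul (Complex.continuous_ofReal.comp hc)

theorem HasL2Partial.smul {j : Fin 3} {u g : E3 → ℂ} (hu : HasL2Partial j u g) {ψ : E3 → ℝ}
    (hψ : ContDiff ℝ ∞ ψ) :
    HasL2Partial j (fun x => ψ x • u x)
      (fun x => ψ x • g x + fderiv ℝ ψ x (EuclideanSpace.single j 1) • u x) := by
  refine ⟨memL2loc_smul hu.1 hψ.continuous, (memL2loc_smul hu.2 hψ.continuous).add
    (memL2loc_smul hu.1 (continuous_fderiv_apply hψ _)), ?_⟩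
  rw [indicator_leibniz, ← smul_indicator_eq]
  exact hu.3.smul hu.1.locallyIntegrable hu.2.locallyIntegrable hψ Set.inter_subset_left

theorem MemL2loc.memLp_indicator {u : E3 → ℂ} (hu : MemL2loc u) {R : ℝ}
    (h0 : ∀ x, R ≤ ‖x‖ → u x = 0) : MemLp (lowerHalf.indicator u) 2 := by
  have : lowerHalf.indicator u = (lowerHalf ∩ Metric.ball 0 R).indicator u := by
    ext x
    by_cases hx : x ∈ lowerHalf
    · by_cases hR : x ∈ Metric.ball (0 : E3) R
      · simp only [Set.indicator_of_mem hx, Set.indicator_of_mem (Set.mem_inter hx hR)]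
      · rw [Set.indicator_of_mem hx, Set.indicator_of_notMem (fun h => hR h.2)]
        exact h0 x (by simpa using hR)
    · rw [Set.indicator_of_notMem hx, Set.indicator_of_notMem (fun h => hx h.1)]
  rw [this, memLp_indicator_iff_restrict (measurableSet_lowerHalf.inter measurableSet_ball)]
  exact hu R

theorem exists_radius {c : E3 → ℝ} (hc : HasCompactSupport c) (e : E3) :
    ∃ R : ℝ, 0 ≤ R ∧ (∀ x, R ≤ ‖x‖ → x ∉ tsupport c) ∧ (∀ x, R ≤ ‖x‖ → c x = 0) ∧
      ∀ x, R ≤ ‖x‖ → fderiv ℝ c x e = 0 := by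
  obtain ⟨R, hR⟩ := hc.isCompact.isBounded.subset_ball (0 : E3)
  have h1 : ∀ x, max R 0 ≤ ‖x‖ → x ∉ tsupport c := by
    intro x hx h
    have h' := hR h
    rw [mem_ball_zero_iff] at h'
    exact absurd ((le_max_left _ _).trans hx) (not_le.2 h')
  refine ⟨max R 0, le_max_right _ _, h1, fun x hx => image_eq_zero_of_notMem_tsupport (h1 x hx),
    fun x hx => ?_⟩
  rw [fderiv_of_notMem_tsupport ℝ (h1 x hx)]
  simp

theorem indicator_eq_zero_of {R : ℝ} {f : E3 → ℂ} (hf : ∀ x, R ≤ ‖x‖ → f x = 0) (x : E3)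
    (hx : R ≤ ‖x‖) : lowerHalf.indicator f x = 0 := by
  by_cases hm : x ∈ lowerHalf
  · rw [Set.indicator_of_mem hm, hf x hx]
  · rw [Set.indicator_of_notMem hm]

/-- Weak derivative of a Lipschitz function of compact support. -/
theorem weakDerivOn_of_lipschitz {a : E3 → ℝ} {C : NNReal} (ha : LipschitzWith C a) (e : E3) :
    WeakDerivOn Set.univ e (fun x => (a x : ℂ)) (fun x => ((lineDeriv ℝ a x e : ℝ) : ℂ)) := by
  intro φ h1 h2 _
  obtain ⟨D, hD⟩ := ContDiff.lipschitzWith_of_hasCompactSupport h2 h1 (by simp)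
  have key := ha.integral_lineDeriv_mul_eq (μ := volume) hD h2 e
  have hl : ∀ x, lineDeriv ℝ φ x (-e) = -fderiv ℝ φ x e := fun x => by
    rw [(h1.differentiable (by simp) x).lineDeriv_eq_fderiv]; simp
  simp only [hl] at key
  simp only [Complex.real_smul, ← Complex.ofReal_mul]
  rw [integral_complex_ofReal, integral_complex_ofReal]
  have e1 : ∫ x, φ x * lineDeriv ℝ a x e = ∫ x, lineDeriv ℝ a x e * φ x := by
    simp only [mul_comm]
  rw [e1, key]
  simp only [neg_mul, integral_neg]
  push_cast
  ring

/-- Leibniz rule for the product with a Lipschitz function of compact support. -/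
theorem HasL2Partial.lipschitz_mul {j : Fin 3} {u g : E3 → ℂ} (hu : HasL2Partial j u g)
    {a : E3 → ℝ} {C : NNReal} (ha : LipschitzWith C a) (hac : HasCompactSupport a) :
    HasL2Partial j (fun x => (a x : ℂ) * u x)
      (fun x => (a x : ℂ) * g x + ((lineDeriv ℝ a x (EuclideanSpace.single j 1) : ℝ) : ℂ) * u x) := by
  set e : E3 := EuclideanSpace.single j 1 with he
  set a' : E3 → ℝ := fun x => lineDeriv ℝ a x e with ha'
  have hcont : Continuous fun x => (a x : ℂ) := Complex.continuous_ofReal.comp ha.continuous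
  have hm' : Measurable a' := measurable_lineDeriv ha.continuous
  have hmc : Measurable fun x => (a' x : ℂ) := Complex.measurable_ofReal.comp hm'
  have hb' : ∀ x, ‖(a' x : ℂ)‖ ≤ C := fun x => by
    have := norm_lineDeriv_le_of_lipschitz ℝ ha (x₀ := x) (v := e)
    simpa [he] using this
  have hL : MemL2loc fun x => (a' x : ℂ) * u x :=
    hu.1.bdd_mul hmc.aestronglyMeasurable fun R => ⟨C, ae_of_all _ fun x _ => hb' x⟩
  refine ⟨hu.1.continuous_mul hcont, (hu.2.continuous_mul hcont).add hL, ?_⟩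
  intro ψ h1 h2 h3
  obtain ⟨R₁, hR₁, -, hψ0, hψ'0⟩ := exists_radius h2 e
  obtain ⟨R₂, hR₂, ha0, -⟩ := exists_radius hac e
  set R := max R₁ R₂
  have hR : 0 ≤ R := hR₁.trans (le_max_left _ _)
  have la : ∀ x, R ≤ ‖x‖ → a x = 0 := fun x hx =>
    image_eq_zero_of_notMem_tsupport (ha0 x ((le_max_right _ _).trans hx))
  have la' : ∀ x, R ≤ ‖x‖ → a' x = 0 := fun x hx => by
    have hev : a =ᶠ[𝓝 x] fun _ => 0 :=
      notMem_tsupport_iff_eventuallyEq.1 (ha0 x ((le_max_right _ _).trans hx))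
    rw [ha']
    simp only
    rw [hev.lineDeriv_eq]
    simp [lineDeriv]
  have hψ0' : ∀ x, R ≤ ‖x‖ → ψ x = 0 := fun x hx => hψ0 x ((le_max_left _ _).trans hx)
  have hψ'0' : ∀ x, R ≤ ‖x‖ → fderiv ℝ ψ x e = 0 := fun x hx =>
    hψ'0 x ((le_max_left _ _).trans hx)
  have M1 : MemLp (fun x => (a x : ℂ)) 2 :=
    hcont.memLp_of_hasCompactSupport (hac.comp_left (g := fun r : ℝ => (r : ℂ)) (by simp))
  have M2 : MemLp (fun x => (a' x : ℂ)) 2 := by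
    have hs : (fun x => (a' x : ℂ)) = (Metric.ball 0 R).indicator fun x => (a' x : ℂ) := by
      ext x
      by_cases hx : x ∈ Metric.ball (0 : E3) R
      · rw [Set.indicator_of_mem hx]
      · rw [Set.indicator_of_notMem hx, la' x (by simpa using hx)]; simp
    have := isFiniteMeasure_ball R
    rw [hs, memLp_indicator_iff_restrict measurableSet_ball]
    exact MemLp.of_bound hmc.aestronglyMeasurable C (ae_of_all _ hb')
  have hsm := hu.smul h1
  -- The support of `ψ` stays away from the boundary, so the extension by zero of `ψ u` is weakly
  -- differentiable on the whole space.
  have W : WeakDerivOn Set.univ e (lowerHalf.indicator fun x => ψ x • u x)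
      (lowerHalf.indicator fun x => ψ x • g x + fderiv ℝ ψ x e • u x) := by
    rw [indicator_leibniz, ← smul_indicator_eq]
    exact hu.3.smul hu.1.locallyIntegrable hu.2.locallyIntegrable h1 (by simpa using h3)
  have z1 : ∀ x, R ≤ ‖x‖ → ψ x • u x = 0 := fun x hx => by simp [hψ0' x hx]
  have z2 : ∀ x, R ≤ ‖x‖ → ψ x • g x + fderiv ℝ ψ x e • u x = 0 := fun x hx => by
    simp [hψ0' x hx, hψ'0' x hx]
  -- Integration by parts on the whole space for `a` against `ψ u` is, after regrouping, the
  -- definition of the weak derivative of `a u` tested with `ψ`.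
  have key := integral_mul_add_eq_zero isOpen_univ (e := e) (by simp [he]) (by simp) M1 M2
    (hsm.1.memLp_indicator z1) (hsm.2.memLp_indicator z2) (weakDerivOn_of_lipschitz ha e) W hR
    (fun x hx => by simp [la x hx]) (fun x hx => by simp [ha'] at la'; simp [ha', la' x hx])
    (indicator_eq_zero_of z1) (indicator_eq_zero_of z2) (by simp) (by simp)
  have i1 : Integrable fun x => ψ x • lowerHalf.indicator
      (fun x => (a x : ℂ) * g x + (a' x : ℂ) * u x) x :=
    ((hu.2.continuous_mul hcont).add hL).integrable_smul h1.continuous h2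
  have i2 : Integrable fun x => fderiv ℝ ψ x e • lowerHalf.indicator (fun x => (a x : ℂ) * u x) x :=
    (hu.1.continuous_mul hcont).integrable_smul (continuous_fderiv_apply h1 _)
      (hasCompactSupport_fderiv_apply h2 _)
  rw [eq_neg_iff_add_eq_zero, ← integral_add i2 i1, ← key]
  refine integral_congr_ae (ae_of_all _ fun x => ?_)
  by_cases hm : x ∈ lowerHalf
  · simp only [Set.indicator_of_mem hm, Complex.real_smul, ha']
    ring
  · simp [hm]

end

/-! ### Boundary traces: uniqueness, algebra and existence. -/

/-- The filter along which boundary values are approached. -/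
abbrev traceFilter : Filter ℝ := 𝓝[>] (0 : ℝ) ⊓ ae volume

theorem eventually_aestronglyMeasurable_slice {u : E3 → ℂ} (hu : AEStronglyMeasurable u volH) :
    ∀ᶠ t in traceFilter, AEStronglyMeasurable (fun y => u (pt y (-t))) volume := by
  obtain ⟨u', hu', hae⟩ := hu
  filter_upwards [eventually_slice hae] with t ht
  refine AEStronglyMeasurable.congr ?_ (EventuallyEq.symm ht)
  have hc : Continuous fun y : E2 => pt y (-t) := continuous_pt.comp (continuous_id.prodMk continuous_const)
  exact (hu'.comp_measurable hc.measurable).aestronglyMeasurable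

theorem IsTrace.congr {u u' : E3 → ℂ} {f f' : E2 → ℂ} (h : IsTrace u f) (hu : u =ᵐ[volH] u')
    (hf : f =ᵐ[volume] f') : IsTrace u' f' := by
  intro R
  refine ⟨(memLp_congr_ae (ae_restrict_of_ae hf)).1 (h R).1, (h R).2.congr' ?_⟩
  filter_upwards [eventually_slice hu] with t ht
  refine eLpNorm_congr_ae (ae_restrict_of_ae ?_)
  filter_upwards [ht, hf] with y h1 h2
  rw [h1, h2]

theorem ae_of_forall_ball {P : E2 → Prop}
    (h : ∀ R : ℝ, ∀ᵐ y ∂(volume.restrict (Metric.ball (0 : E2) R)), P y) : ∀ᵐ y, P y := by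
  have h1 : ∀ᵐ y : E2, ∀ n : ℕ, y ∈ Metric.ball (0 : E2) n → P y :=
    ae_all_iff.2 fun n => (ae_restrict_iff' measurableSet_ball).1 (h n)
  filter_upwards [h1] with y hy
  obtain ⟨n, hn⟩ := exists_nat_gt ‖y‖
  exact hy n (by simpa using hn)

theorem IsTrace.unique {u : E3 → ℂ} {f f' : E2 → ℂ} (hu : AEStronglyMeasurable u volH)
    (h : IsTrace u f) (h' : IsTrace u f') : f =ᵐ[volume] f' := by
  refine ae_of_forall_ball fun R => ?_
  set μ := (volume : Measure E2).restrict (Metric.ball 0 R)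
  have h0 : eLpNorm (fun y => f' y - f y) 2 μ = 0 := by
    refine le_antisymm ?_ zero_le
    have hlim := (h R).2.add (h' R).2
    rw [add_zero] at hlim
    -- The norm of `f' - f` does not depend on `t`, and is bounded by a quantity tending to zero
    -- along a nontrivial filter.
    refine ge_of_tendsto hlim ?_
    filter_upwards [eventually_aestronglyMeasurable_slice hu] with t ht
    have hm : AEStronglyMeasurable (fun y => u (pt y (-t))) μ := ht.restrict
    have := eLpNorm_sub_le (hm.sub (h R).1.1) (hm.sub (h' R).1.1) (p := 2) (by norm_num)
    refine le_trans (le_of_eq ?_) this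
    congr 1
    ext y
    simp only [Pi.sub_apply]
    ring
  have h1 := (eLpNorm_eq_zero_iff (f := fun y => f' y - f y) ((h' R).1.1.sub (h R).1.1)
    (by norm_num)).1 h0
  filter_upwards [h1] with y hy
  exact (sub_eq_zero.1 hy).symm

theorem IsTrace.add {u v : E3 → ℂ} {f g : E2 → ℂ} (hu : AEStronglyMeasurable u volH)
    (hv : AEStronglyMeasurable v volH) (h : IsTrace u f) (h' : IsTrace v g) :
    IsTrace (fun x => u x + v x) (fun y => f y + g y) := by
  intro R
  refine ⟨(h R).1.add (h' R).1, ?_⟩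
  have hlim := (h R).2.add (h' R).2
  rw [add_zero] at hlim
  refine tendsto_of_tendsto_of_tendsto_of_le_of_le' tendsto_const_nhds hlim
    (Eventually.of_forall fun _ => zero_le) ?_
  filter_upwards [eventually_aestronglyMeasurable_slice hu,
    eventually_aestronglyMeasurable_slice hv] with t h1 h2
  have := eLpNorm_add_le (h1.restrict.sub (h R).1.1) (h2.restrict.sub (h' R).1.1) (p := 2)
    (by norm_num)
  refine le_trans (le_of_eq ?_) this
  congr 1
  ext y
  simp only [Pi.sub_apply, Pi.add_apply]
  ring

theorem IsTrace.conj {u : E3 → ℂ} {f : E2 → ℂ} (h : IsTrace u f) :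
    IsTrace (fun x => (starRingEnd ℂ) (u x)) (fun y => (starRingEnd ℂ) (f y)) := by
  intro R
  refine ⟨(h R).1.star, (h R).2.congr fun t => ?_⟩
  refine eLpNorm_congr_norm_ae (ae_of_all _ fun y => ?_)
  rw [← map_sub, RCLike.norm_conj]

/-- Traces are compatible with the product with Lipschitz functions. -/
theorem IsTrace.mul {u : E3 → ℂ} {f : E2 → ℂ} (hu : AEStronglyMeasurable u volH)
    (h : IsTrace u f) {c : E3 → ℂ} {C : NNReal} (hc : LipschitzWith C c) :
    IsTrace (fun x => c x * u x) (fun y => c (pt y 0) * f y) := by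
  intro R
  set μ := (volume : Measure E2).restrict (Metric.ball 0 R) with hμ
  have hpc : ∀ t : ℝ, Continuous fun y : E2 => pt y t := fun t => continuous_pt.comp (continuous_id.prodMk continuous_const)
  obtain ⟨M, hM0, hM⟩ := exists_bound_ball hc.continuous (R + 1)
  have hmem : ∀ {y : E2} {t : ℝ}, ‖y‖ < R → |t| < 1 → pt y t ∈ Metric.ball (0 : E3) (R + 1) := by
    intro y t hy ht
    rw [mem_ball_zero_iff]
    exact (norm_pt_le y t).trans_lt (add_lt_add hy ht)
  have hmeas : ∀ t : ℝ, AEStronglyMeasurable (fun y : E2 => c (pt y t)) μ := fun t =>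
    (hc.continuous.comp (hpc t)).aestronglyMeasurable
  constructor
  · refine (h R).1.of_le_mul (c := M) ((hmeas 0).mul (h R).1.1) ?_
    filter_upwards [ae_restrict_mem measurableSet_ball] with y hy
    rw [norm_mul]
    exact mul_le_mul_of_nonneg_right (hM _ (hmem (by simpa using hy) (by simp))) (norm_nonneg _)
  -- The error splits as `c(y,-t) (u(y,-t) - f) + (c(y,-t) - c(y,0)) f`: the first term is
  -- controlled by the bound `M` of `c`, the second by its Lipschitz constant times `t`.
  have hlim : Tendsto (fun t : ℝ => ENNReal.ofReal M * eLpNorm (fun y => u (pt y (-t)) - f y) 2 μ +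
      ENNReal.ofReal (C * t) * eLpNorm f 2 μ) traceFilter (𝓝 0) := by
    have l1 := ENNReal.Tendsto.const_mul (a := ENNReal.ofReal M) (h R).2 (Or.inr (by simp))
    have l2 : Tendsto (fun t : ℝ => ENNReal.ofReal (C * t)) traceFilter (𝓝 0) := by
      have hcont : Continuous fun t : ℝ => ENNReal.ofReal (C * t) :=
        ENNReal.continuous_ofReal.comp (by fun_prop)
      have := (hcont.tendsto 0).mono_left (inf_le_left.trans nhdsWithin_le_nhds :
        traceFilter ≤ 𝓝 0)
      simpa using this
    have l3 := ENNReal.Tendsto.mul_const (b := eLpNorm f 2 μ) l2 (Or.inr (h R).1.2.ne)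
    simpa using l1.add l3
  refine tendsto_of_tendsto_of_tendsto_of_le_of_le' tendsto_const_nhds hlim
    (Eventually.of_forall fun _ => zero_le) ?_
  have ht1 : ∀ᶠ t in traceFilter, t ∈ Set.Ioo (0 : ℝ) 1 :=
    Eventually.filter_mono inf_le_left (Ioo_mem_nhdsGT one_pos)
  filter_upwards [eventually_aestronglyMeasurable_slice hu, ht1] with t hm ht
  have m1 : AEStronglyMeasurable (fun y => c (pt y (-t)) * (u (pt y (-t)) - f y)) μ :=
    (hmeas _).mul (hm.restrict.sub (h R).1.1)
  have m2 : AEStronglyMeasurable (fun y => (c (pt y (-t)) - c (pt y 0)) * f y) μ :=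
    ((hmeas _).sub (hmeas _)).mul (h R).1.1
  have tri := eLpNorm_add_le m1 m2 (p := 2) (by norm_num)
  have b1 : eLpNorm (fun y => c (pt y (-t)) * (u (pt y (-t)) - f y)) 2 μ ≤
      ENNReal.ofReal M * eLpNorm (fun y => u (pt y (-t)) - f y) 2 μ := by
    refine eLpNorm_le_mul_eLpNorm_of_ae_le_mul ?_ 2
    filter_upwards [ae_restrict_mem measurableSet_ball] with y hy
    rw [norm_mul]
    refine mul_le_mul_of_nonneg_right (hM _ (hmem (by simpa using hy) ?_)) (norm_nonneg _)
    rw [abs_neg, abs_of_pos ht.1]; exact ht.2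
  have b2 : eLpNorm (fun y => (c (pt y (-t)) - c (pt y 0)) * f y) 2 μ ≤
      ENNReal.ofReal (C * t) * eLpNorm f 2 μ := by
    refine eLpNorm_le_mul_eLpNorm_of_ae_le_mul (ae_of_all _ fun y => ?_) 2
    rw [norm_mul]
    refine mul_le_mul_of_nonneg_right ?_ (norm_nonneg _)
    have h1 := hc.norm_sub_le (pt y (-t)) (pt y 0)
    have h2 : pt y (-t) - pt y 0 = pt 0 (-t) := by
      ext i; fin_cases i <;> simp [pt]
    have h3 : ‖pt 0 (-t)‖ ≤ t := by
      refine (norm_pt_le _ _).trans ?_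
      rw [norm_zero, abs_neg, abs_of_pos ht.1, zero_add]
    rw [h2] at h1
    exact h1.trans (mul_le_mul_of_nonneg_left h3 C.2)
  refine le_trans (le_of_eq ?_) (tri.trans (add_le_add b1 b2))
  congr 1
  ext y
  simp only [Pi.add_apply]
  ring

theorem IsTrace.const_mul {u : E3 → ℂ} {f : E2 → ℂ} (hu : AEStronglyMeasurable u volH)
    (h : IsTrace u f) (c : ℂ) : IsTrace (fun x => c * u x) (fun y => c * f y) :=
  h.mul hu (LipschitzWith.const c)

/-- A compactly supported function in `H¹` vanishing outside a ball has a trace. -/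
theorem HasL2Partial.isTrace_lineTrace {u g : E3 → ℂ} (h : HasL2Partial 2 u g) {R : ℝ}
    (hR : 0 ≤ R) (hu0 : ∀ x, R ≤ ‖x‖ → u x = 0) (hg0 : ∀ x, R ≤ ‖x‖ → g x = 0) :
    IsTrace u (lineTrace (lowerHalf.indicator g)) := by
  have hi := integrable_of_memLp_two_of_bounded (h.1.memLp_indicator hu0) 0
    (by simpa using indicator_eq_zero_of hu0)
  have := HalfSpace.isTrace_lineTrace h.3 hi (h.2.memLp_indicator hg0) hR (indicator_eq_zero_of hu0) (indicator_eq_zero_of hg0)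
    (fun x hx => Set.indicator_of_notMem hx _)
  refine this.congr ?_ EventuallyEq.rfl
  rw [EventuallyEq, ae_volH_iff]
  exact ae_of_all _ fun x hx => Set.indicator_of_mem hx _

/-- A smooth function of the height that is `1` near the boundary and `0` far below. -/
def heightCutoff (x : E3) : ℝ := Real.smoothTransition (x 2 + 2)

theorem contDiff_heightCutoff : ContDiff ℝ ∞ heightCutoff := by
  unfold heightCutoff
  refine Real.smoothTransition.contDiff.comp ?_
  fun_prop

theorem heightCutoff_eq_one {x : E3} (hx : -1 ≤ x 2) : heightCutoff x = 1 :=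
  Real.smoothTransition.one_of_one_le (by linarith)

theorem heightCutoff_eq_zero {x : E3} (hx : x 2 ≤ -2) : heightCutoff x = 0 :=
  Real.smoothTransition.zero_of_nonpos (by linarith)

theorem fderiv_heightCutoff_eq_zero {x : E3} (hx : x 2 < -2) : fderiv ℝ heightCutoff x = 0 := by
  have : heightCutoff =ᶠ[𝓝 x] fun _ => 0 := by
    have ho : IsOpen {x : E3 | x 2 < -2} := isOpen_lt (by fun_prop) continuous_const
    filter_upwards [ho.mem_nhds hx] with z hz
    exact heightCutoff_eq_zero (le_of_lt hz)
  rw [this.fderiv_eq]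
  simp

/-- Existence of smooth cutoffs, equal to `1` on a given ball. -/
theorem exists_cutoff (R : ℝ) : ∃ χ : E3 → ℝ, ContDiff ℝ ∞ χ ∧ HasCompactSupport χ ∧
    (∀ x, ‖x‖ < R → χ x = 1) ∧ ∀ x, ‖x‖ < R → fderiv ℝ χ x = 0 := by
  let b : ContDiffBump (0 : E3) := ⟨|R| + 1, |R| + 2, by positivity, by linarith⟩
  have h1 : ∀ x, ‖x‖ < R → (b : E3 → ℝ) =ᶠ[𝓝 x] fun _ => 1 := by
    intro x hx
    have ho : Metric.ball (0 : E3) R ∈ 𝓝 x := Metric.isOpen_ball.mem_nhds (by simpa using hx)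
    filter_upwards [ho] with z hz
    refine b.one_of_mem_closedBall ?_
    simp only [mem_closedBall_zero_iff]
    have h2 : ‖z‖ < R := by simpa using hz
    change ‖z‖ ≤ |R| + 1
    linarith [le_abs_self R]
  refine ⟨b, b.contDiff, b.hasCompactSupport, fun x hx => (h1 x hx).eq_of_nhds, fun x hx => ?_⟩
  rw [(h1 x hx).fderiv_eq]
  simp

/-- The trace theorem. -/
theorem HasL2Partial.exists_isTrace {u g : E3 → ℂ} (h : HasL2Partial 2 u g) :
    ∃ f, IsTrace u f := by
  set e : E3 := EuclideanSpace.single 2 1 with he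
  set b : E3 → ℂ := fun x => heightCutoff x • g x + fderiv ℝ heightCutoff x e • u x with hb
  refine ⟨lineTrace (lowerHalf.indicator b), fun R => ?_⟩
  -- `heightCutoff` lives at heights at least `-2`, so the relevant part of every vertical line over
  -- the ball of radius `R` lies where `χ = 1`. The candidate trace is therefore independent of `R`.
  obtain ⟨χ, hχ, hχc, hχ1, hχd⟩ := exists_cutoff (R + 3)
  have hbH := h.smul contDiff_heightCutoff
  have hbχ := hbH.smul hχ
  obtain ⟨R', hR', -, hχ0, hχd0⟩ := exists_radius hχc e
  have T := hbχ.isTrace_lineTrace hR' (fun x hx => by simp [hχ0 x hx])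
    (fun x hx => by simp [hχ0 x hx, hχd0 x hx, ← he]) R
  have e1 : ∀ y ∈ Metric.ball (0 : E2) R, lineTrace (lowerHalf.indicator fun x =>
      χ x • (heightCutoff x • g x + fderiv ℝ heightCutoff x e • u x) +
        fderiv ℝ χ x e • heightCutoff x • u x) y = lineTrace (lowerHalf.indicator b) y := by
    intro y hy
    rw [lineTrace, lineTrace]
    refine integral_congr_ae (ae_of_all _ fun s => ?_)
    by_cases hm : pt y s ∈ lowerHalf
    · simp only [Set.indicator_of_mem hm, hb]
      by_cases hs : s < -2
      · have h1 : heightCutoff (pt y s) = 0 := heightCutoff_eq_zero hs.le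
        have h2 : fderiv ℝ heightCutoff (pt y s) = 0 := fderiv_heightCutoff_eq_zero hs
        simp [h1, h2]
      · have hs0 : s < 0 := hm
        have hn : ‖pt y s‖ < R + 3 := by
          refine (norm_pt_le y s).trans_lt (add_lt_add (by simpa using hy) ?_)
          rw [abs_of_neg hs0]; linarith
        simp [hχ1 _ hn, hχd _ hn]
    · simp only [Set.indicator_of_notMem hm]
  have e1' : ∀ᵐ y ∂(volume : Measure E2).restrict (Metric.ball 0 R), _ :=
    (ae_restrict_mem measurableSet_ball).mono e1
  refine ⟨(memLp_congr_ae e1').1 T.1, T.2.congr' ?_⟩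
  have ht1 : ∀ᶠ t in traceFilter, t ∈ Set.Ioo (0 : ℝ) 1 :=
    Eventually.filter_mono inf_le_left (Ioo_mem_nhdsGT one_pos)
  filter_upwards [ht1] with t ht
  refine eLpNorm_congr_ae ?_
  filter_upwards [ae_restrict_mem measurableSet_ball] with y hy
  have hn : ‖pt y (-t)‖ < R + 3 := by
    refine (norm_pt_le y _).trans_lt (add_lt_add (by simpa using hy) ?_)
    rw [abs_neg, abs_of_pos ht.1]; linarith [ht.2]
  have hc : heightCutoff (pt y (-t)) = 1 := heightCutoff_eq_one (by
    rw [pt_two]; linarith [ht.2])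
  rw [e1 y hy, hχ1 _ hn, hc, one_smul, one_smul]

theorem isTrace_boundaryTrace {u : E3 → ℂ} (h : ∃ f, IsTrace u f) :
    IsTrace u (boundaryTrace u) := by
  rw [boundaryTrace, dif_pos h]
  exact h.choose_spec

theorem MemH1loc.isTrace {u : E3 → ℂ} (h : MemH1loc u) : IsTrace u (boundaryTrace u) :=
  isTrace_boundaryTrace (h.hasL2Partial 2).exists_isTrace

/-! ### Localized integration by parts up to the boundary. -/

theorem integral_localized_eq {e : E3} (p a w b : E3 → ℂ) {φ χ : E3 → ℝ} {R : ℝ}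
    (hφ0 : ∀ x, R ≤ ‖x‖ → φ x = 0) (hφd : ∀ x, R ≤ ‖x‖ → fderiv ℝ φ x e = 0)
    (hχ1 : ∀ x, ‖x‖ < R → χ x = 1) (hχd : ∀ x, ‖x‖ < R → fderiv ℝ χ x = 0) :
    ∫ x, (φ x • (a x * w x + p x * b x) + fderiv ℝ φ x e • (p x * w x)) ∂volH =
      ∫ x, (lowerHalf.indicator (fun x => χ x • a x + fderiv ℝ χ x e • p x) x *
        lowerHalf.indicator (fun x => φ x • w x) x + lowerHalf.indicator (fun x => χ x • p x) x *
        lowerHalf.indicator (fun x => φ x • b x + fderiv ℝ φ x e • w x) x) := by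
  rw [volH, ← integral_indicator measurableSet_lowerHalf]
  refine integral_congr_ae (ae_of_all _ fun x => ?_)
  by_cases hm : x ∈ lowerHalf
  · simp only [Set.indicator_of_mem hm]
    rcases lt_or_ge ‖x‖ R with hx | hx
    · simp only [hχ1 x hx, hχd x hx, Complex.real_smul, _root_.zero_apply]
      push_cast
      ring
    · simp [hφ0 x hx, hφd x hx]
  · simp [hm]

/-- Integration by parts up to the boundary, localized by a test function: tangential
directions. -/
theorem HasL2Partial.integral_tangential {j : Fin 3} (hj : j ≠ 2) {p a w b : E3 → ℂ}
    (hp : HasL2Partial j p a) (hw : HasL2Partial j w b) {φ : E3 → ℝ} (hφ : ContDiff ℝ ∞ φ)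
    (hc : HasCompactSupport φ) :
    ∫ x, (φ x • (a x * w x + p x * b x) +
      fderiv ℝ φ x (EuclideanSpace.single j 1) • (p x * w x)) ∂volH = 0 := by
  set e : E3 := EuclideanSpace.single j 1 with he
  obtain ⟨R, hR, -, hφ0, hφd⟩ := exists_radius hc e
  -- As `χ = 1` where `φ` or its derivative along `e` is nonzero, replacing `p` by `χ p` leaves the
  -- integral unchanged and makes both factors of bounded support.
  obtain ⟨χ, hχ, hχc, hχ1, hχd⟩ := exists_cutoff R
  obtain ⟨R', hR', -, hχ0, hχd0⟩ := exists_radius hχc e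
  rw [integral_localized_eq p a w b hφ0 hφd hχ1 hχd]
  have hp' := hp.smul hχ
  have hw' := hw.smul hφ
  have z1 : ∀ x, max R R' ≤ ‖x‖ → χ x • p x = 0 := fun x hx => by
    simp [hχ0 x ((le_max_right _ _).trans hx)]
  have z2 : ∀ x, max R R' ≤ ‖x‖ → χ x • a x + fderiv ℝ χ x e • p x = 0 := fun x hx => by
    simp [hχ0 x ((le_max_right _ _).trans hx), hχd0 x ((le_max_right _ _).trans hx)]
  have z3 : ∀ x, max R R' ≤ ‖x‖ → φ x • w x = 0 := fun x hx => by
    simp [hφ0 x ((le_max_left _ _).trans hx)]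
  have z4 : ∀ x, max R R' ≤ ‖x‖ → φ x • b x + fderiv ℝ φ x e • w x = 0 := fun x hx => by
    simp [hφ0 x ((le_max_left _ _).trans hx), hφd x ((le_max_left _ _).trans hx)]
  refine integral_mul_add_eq_zero isOpen_lowerHalf (e := e) (by simp [he]) ?_
    (hp'.1.memLp_indicator z1) (hp'.2.memLp_indicator z2) (hw'.1.memLp_indicator z3)
    (hw'.2.memLp_indicator z4) hp'.3 hw'.3 (hR.trans (le_max_left R R'))
    (indicator_eq_zero_of z1) (indicator_eq_zero_of z2) (indicator_eq_zero_of z3)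
    (indicator_eq_zero_of z4) (fun x hx => Set.indicator_of_notMem hx _)
    (fun x hx => Set.indicator_of_notMem hx _)
  intro x hx s
  have : (x - s • e) 2 = x 2 := by simp [he, hj.symm]
  change (x - s • e) 2 < 0
  rw [this]
  exact hx

theorem IsTrace.smul {u : E3 → ℂ} {f : E2 → ℂ} (hu : AEStronglyMeasurable u volH)
    (h : IsTrace u f) {φ : E3 → ℝ} (hφ : ContDiff ℝ ∞ φ) (hc : HasCompactSupport φ) :
    IsTrace (fun x => φ x • u x) (fun y => φ (pt y 0) • f y) := by
  obtain ⟨D, hD⟩ := ContDiff.lipschitzWith_of_hasCompactSupport hc hφ (by simp)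
  have : LipschitzWith D fun x => (φ x : ℂ) := LipschitzWith.of_dist_le_mul fun x y => by
    rw [Complex.isometry_ofReal.dist_eq]
    exact hD.dist_le_mul x y
  simpa only [Complex.real_smul] using h.mul hu this

/-- Integration by parts up to the boundary, localized by a test function: vertical direction. -/
theorem HasL2Partial.integral_normal {p a w b : E3 → ℂ}
    (hp : HasL2Partial 2 p a) (hw : HasL2Partial 2 w b) {f h : E2 → ℂ} (hf : IsTrace p f)
    (hh : IsTrace w h) {φ : E3 → ℝ} (hφ : ContDiff ℝ ∞ φ) (hc : HasCompactSupport φ) :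
    ∫ x, (φ x • (a x * w x + p x * b x) +
      fderiv ℝ φ x (EuclideanSpace.single 2 1) • (p x * w x)) ∂volH =
      ∫ y, φ (pt y 0) • (f y * h y) := by
  set e : E3 := EuclideanSpace.single 2 1 with he
  obtain ⟨R, hR, -, hφ0, hφd⟩ := exists_radius hc e
  obtain ⟨χ, hχ, hχc, hχ1, hχd⟩ := exists_cutoff R
  obtain ⟨R', hR', -, hχ0, hχd0⟩ := exists_radius hχc e
  rw [integral_localized_eq p a w b hφ0 hφd hχ1 hχd]
  have hp' := hp.smul hχ
  have hw' := hw.smul hφ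
  have z1 : ∀ x, max R R' ≤ ‖x‖ → χ x • p x = 0 := fun x hx => by
    simp [hχ0 x ((le_max_right _ _).trans hx)]
  have z2 : ∀ x, max R R' ≤ ‖x‖ → χ x • a x + fderiv ℝ χ x e • p x = 0 := fun x hx => by
    simp [hχ0 x ((le_max_right _ _).trans hx), hχd0 x ((le_max_right _ _).trans hx)]
  have z3 : ∀ x, max R R' ≤ ‖x‖ → φ x • w x = 0 := fun x hx => by
    simp [hφ0 x ((le_max_left _ _).trans hx)]
  have z4 : ∀ x, max R R' ≤ ‖x‖ → φ x • b x + fderiv ℝ φ x e • w x = 0 := fun x hx => by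
    simp [hφ0 x ((le_max_left _ _).trans hx), hφd x ((le_max_left _ _).trans hx)]
  have hRR := hR.trans (le_max_left R R')
  rw [integral_mul_add_eq_lineTrace (hp'.1.memLp_indicator z1) (hp'.2.memLp_indicator z2)
    (hw'.1.memLp_indicator z3) (hw'.2.memLp_indicator z4) hp'.3 hw'.3 hRR
    (indicator_eq_zero_of z1) (indicator_eq_zero_of z2) (indicator_eq_zero_of z3)
    (indicator_eq_zero_of z4) (fun x hx => Set.indicator_of_notMem hx _)
    (fun x hx => Set.indicator_of_notMem hx _)]
  -- Uniqueness identifies the line integrals with the cut off traces `χ f` and `φ h`.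
  have t1 := (hp'.isTrace_lineTrace hRR z1 z2).unique hp'.1.aestronglyMeasurable
    (hf.smul hp.1.aestronglyMeasurable hχ hχc)
  have t2 := (hw'.isTrace_lineTrace hRR z3 z4).unique hw'.1.aestronglyMeasurable
    (hh.smul hw.1.aestronglyMeasurable hφ hc)
  refine integral_congr_ae ?_
  filter_upwards [t1, t2] with y h1 h2
  rw [h1, h2]
  rcases lt_or_ge ‖pt y 0‖ R with hx | hx
  · simp only [hχ1 _ hx, Complex.real_smul]
    push_cast
    ring
  · simp [hφ0 _ hx]

/-! ### The localized magnetic Green formula. -/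

section

theorem integrable_smul_mul {X : Type*} [MeasurableSpace X] [SeminormedAddCommGroup X]
    [OpensMeasurableSpace X] {μ : Measure X} {φ : X → ℝ} {f g : X → ℂ}
    (hf : ∀ R : ℝ, MemLp f 2 (μ.restrict (Metric.ball 0 R)))
    (hg : ∀ R : ℝ, MemLp g 2 (μ.restrict (Metric.ball 0 R)))
    (hφ : AEStronglyMeasurable φ μ) {C R : ℝ} (hC : ∀ x, ‖φ x‖ ≤ C)
    (h0 : ∀ x, R ≤ ‖x‖ → φ x = 0) : Integrable (fun x => φ x • (f x * g x)) μ := by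
  have h1 : IntegrableOn (fun x => φ x • (f x * g x)) (Metric.ball 0 R) μ :=
    ((hf R).integrable_mul (hg R)).bdd_smul C hφ.restrict (ae_of_all _ hC)
  refine (integrableOn_iff_integrable_of_support_subset fun x hx => ?_).1 h1
  by_contra h
  exact hx (by simp only [h0 x (by simpa using h), zero_smul])

theorem MemL2loc.integrable_smul_mul {f g : E3 → ℂ} (hf : MemL2loc f) (hg : MemL2loc g)
    {φ : E3 → ℝ} (hφ : Continuous φ) (hc : HasCompactSupport φ) :
    Integrable (fun x => φ x • (f x * g x)) volH := by
  obtain ⟨C, hC⟩ := hc.exists_bound_of_continuous hφ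
  obtain ⟨R, -, -, h0, -⟩ := exists_radius hc 0
  exact HalfSpace.integrable_smul_mul (memL2loc_iff.1 hf) (memL2loc_iff.1 hg)
    hφ.aestronglyMeasurable hC h0

theorem integrable_smul_mul_trace {f g : E2 → ℂ}
    (hf : ∀ R : ℝ, MemLp f 2 (volume.restrict (Metric.ball 0 R)))
    (hg : ∀ R : ℝ, MemLp g 2 (volume.restrict (Metric.ball 0 R)))
    {φ : E3 → ℝ} (hφ : Continuous φ) (hc : HasCompactSupport φ) :
    Integrable (fun y => φ (pt y 0) • (f y * g y)) := by
  obtain ⟨C, hC⟩ := hc.exists_bound_of_continuous hφ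
  obtain ⟨R, -, -, h0, -⟩ := exists_radius hc 0
  refine HalfSpace.integrable_smul_mul hf hg ?_ (fun y => hC _)
    fun y hy => h0 _ (hy.trans (norm_le_norm_pt y 0))
  exact (hφ.comp (continuous_pt.comp
    (continuous_id.prodMk continuous_const))).aestronglyMeasurable

variable {A : E3 → E3} {u v : E3 → ℂ}

theorem MemW1infComp.coord (hA : MemW1infComp A) (j : Fin 3) :
    (∃ C : NNReal, LipschitzWith C fun x => A x j) ∧ HasCompactSupport fun x => A x j := by
  obtain ⟨⟨C, hC⟩, hc⟩ := hA
  refine ⟨⟨C, LipschitzWith.of_dist_le_mul fun x y => ?_⟩,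
    hc.comp_left (g := fun z : E3 => z j) (by simp)⟩
  refine le_trans ?_ (hC.dist_le_mul x y)
  rw [dist_eq_norm, dist_eq_norm]
  exact PiLp.norm_apply_le (A x - A y) j

theorem MemH1loc.add (hu : MemH1loc u) (hv : MemH1loc v) : MemH1loc fun x => u x + v x :=
  memH1loc_of fun j => ⟨_, (hu.hasL2Partial j).add (hv.hasL2Partial j)⟩

theorem MemH1loc.const_mul (hu : MemH1loc u) (c : ℂ) : MemH1loc fun x => c * u x :=
  memH1loc_of fun j => ⟨_, (hu.hasL2Partial j).const_mul c⟩

theorem MemH1loc.coord_mul (hu : MemH1loc u) (hA : MemW1infComp A) (i : Fin 3) :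
    MemH1loc fun x => (A x i : ℂ) * u x := by
  obtain ⟨⟨C, hC⟩, hc⟩ := hA.coord i
  exact memH1loc_of fun j => ⟨_, (hu.hasL2Partial j).lipschitz_mul hC hc⟩

theorem MemH2loc.magPartial (hu : MemH2loc u) (hA : MemW1infComp A) (j : Fin 3) :
    MemH1loc (magPartial A j u) :=
  ((hu.memH1loc_weakPartial j).const_mul _).add (hu.memH1loc.coord_mul hA j)

theorem MemH1loc.magPartial (hu : MemH1loc u) (hA : MemW1infComp A) (j : Fin 3) :
    MemL2loc (magPartial A j u) :=
  ((hu.hasL2Partial j).const_mul _).2.add (hu.coord_mul hA j).1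

theorem lipschitz_ofReal_coord (hA : MemW1infComp A) (j : Fin 3) :
    ∃ C : NNReal, LipschitzWith C fun x => (A x j : ℂ) := by
  obtain ⟨⟨C, hC⟩, -⟩ := hA.coord j
  refine ⟨C, LipschitzWith.of_dist_le_mul fun x y => ?_⟩
  rw [Complex.isometry_ofReal.dist_eq]
  exact hC.dist_le_mul x y

/-- The reason is `-i∂ₙ + Aₙ = -i (∂ₙ + i Aₙ)`, since the outer normal is the last coordinate
direction. -/
theorem isTrace_magPartial (hu : MemH2loc u) (hA : MemW1infComp A) :
    IsTrace (magPartial A 2 u) fun y => -Complex.I * magNormalDeriv A u y := by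
  obtain ⟨C, hC⟩ := lipschitz_ofReal_coord hA 2
  have h1 := (hu.memH1loc_weakPartial 2).isTrace.const_mul
    (hu.memH1loc_weakPartial 2).1.aestronglyMeasurable (-Complex.I)
  have h2 := hu.memH1loc.isTrace.mul hu.1.aestronglyMeasurable hC
  have h3 := h1.add ((hu.memH1loc_weakPartial 2).const_mul _).1.aestronglyMeasurable
    (hu.memH1loc.coord_mul hA 2).1.aestronglyMeasurable h2
  refine h3.congr EventuallyEq.rfl (ae_of_all _ fun y => ?_)
  simp only [magNormalDeriv]
  linear_combination ((A (pt y 0) 2 : ℂ) * boundaryTrace u y) * Complex.I_sq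

theorem memLp_magNormalDeriv (hu : MemH2loc u) (hA : MemW1infComp A) (R : ℝ) :
    MemLp (magNormalDeriv A u) 2 (volume.restrict (Metric.ball 0 R)) := by
  have h := (isTrace_magPartial hu hA R).1.const_mul Complex.I
  refine (memLp_congr_ae (ae_of_all _ fun y => ?_)).1 h
  linear_combination (-magNormalDeriv A u y) * Complex.I_sq

theorem MemH2loc.isTrace (hu : MemH2loc u) : IsTrace u (boundaryTrace u) := hu.memH1loc.isTrace

/-- The localized integrand of the magnetic Green formula in one direction. -/
theorem magPartial_identity (A : E3 → E3) (j : Fin 3) (p v : E3 → ℂ) (φ : E3 → ℝ) (e x : E3) :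
    φ x • (magPartial A j p x * conj (v x)) - φ x • (p x * conj (magPartial A j v x))
      - Complex.I * (fderiv ℝ φ x e • (p x * conj (v x))) =
    -Complex.I * (φ x • (weakPartial j p x * conj (v x) + p x * conj (weakPartial j v x)) +
      fderiv ℝ φ x e • (p x * conj (v x))) := by
  simp only [magPartial, Complex.real_smul, map_add, map_mul, map_neg, Complex.conj_I,
    Complex.conj_ofReal]
  ring

/-- As `A` is real, its contributions cancel, and the integrand is `-i` times the derivative of the
product `φ p v̄`. Parallel to the boundary this integrates to zero. -/
theorem magGreen_tangential (A : E3 → E3) {j : Fin 3} (hj : j ≠ 2) {p : E3 → ℂ}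
    (hp : MemH1loc p) (hv : MemH1loc v) {φ : E3 → ℝ} (hφ : ContDiff ℝ ∞ φ)
    (hc : HasCompactSupport φ) :
    ∫ x, (φ x • (magPartial A j p x * conj (v x)) - φ x • (p x * conj (magPartial A j v x))
      - Complex.I * (fderiv ℝ φ x (EuclideanSpace.single j 1) • (p x * conj (v x)))) ∂volH = 0 := by
  simp only [magPartial_identity]
  rw [integral_const_mul,
    (hp.hasL2Partial j).integral_tangential hj (hv.hasL2Partial j).conj hφ hc, mul_zero]

theorem magGreen_normal (A : E3 → E3) {p : E3 → ℂ} {f h : E2 → ℂ}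
    (hp : MemH1loc p) (hv : MemH1loc v) (hf : IsTrace p f) (hh : IsTrace v h)
    {φ : E3 → ℝ} (hφ : ContDiff ℝ ∞ φ) (hc : HasCompactSupport φ) :
    ∫ x, (φ x • (magPartial A 2 p x * conj (v x)) - φ x • (p x * conj (magPartial A 2 v x))
      - Complex.I * (fderiv ℝ φ x (EuclideanSpace.single 2 1) • (p x * conj (v x)))) ∂volH =
    -Complex.I * ∫ y, φ (pt y 0) • (f y * conj (h y)) := by
  simp only [magPartial_identity]
  rw [integral_const_mul,
    (hp.hasL2Partial 2).integral_normal (hv.hasL2Partial 2).conj hf hh.conj hφ hc]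

/-- The second order integrand in one direction. -/
def greenTerm (A : E3 → E3) (φ : E3 → ℝ) (u v : E3 → ℂ) (j : Fin 3) (x : E3) : ℂ :=
  φ x • (magPartial A j (magPartial A j u) x * conj (v x) -
      u x * conj (magPartial A j (magPartial A j v) x)) -
    Complex.I * (fderiv ℝ φ x (EuclideanSpace.single j 1) •
      (magPartial A j u x * conj (v x) + u x * conj (magPartial A j v x)))

/-- One half of the integrand of `greenTerm`. -/
def halfTerm (A : E3 → E3) (φ : E3 → ℝ) (p v : E3 → ℂ) (j : Fin 3) (x : E3) : ℂ :=
  φ x • (magPartial A j p x * conj (v x)) - φ x • (p x * conj (magPartial A j v x))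
      - Complex.I * (fderiv ℝ φ x (EuclideanSpace.single j 1) • (p x * conj (v x)))

/-- The two halves share the product of the first magnetic derivatives of `u` and `v`, which cancels
in the difference; second order terms and terms with `∇φ` remain. -/
theorem greenTerm_eq (A : E3 → E3) (φ : E3 → ℝ) (u v : E3 → ℂ) (j : Fin 3) (x : E3) :
    greenTerm A φ u v j x = halfTerm A φ (magPartial A j u) v j x -
      conj (halfTerm A φ (magPartial A j v) u j x) := by
  simp only [greenTerm, halfTerm, Complex.real_smul, map_sub, map_mul, Complex.conj_I,
    Complex.conj_ofReal, Complex.conj_conj]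
  ring

theorem integrable_halfTerm (hA : MemW1infComp A) {p : E3 → ℂ} (hp : MemH1loc p)
    (hv : MemH1loc v) {φ : E3 → ℝ} (hφ : ContDiff ℝ ∞ φ) (hc : HasCompactSupport φ)
    (j : Fin 3) : Integrable (halfTerm A φ p v j) volH := by
  have i1 := (hp.magPartial hA j).integrable_smul_mul hv.1.conj hφ.continuous hc
  have i2 := hp.1.integrable_smul_mul (hv.magPartial hA j).conj hφ.continuous hc
  have i3 := hp.1.integrable_smul_mul hv.1.conj
    (continuous_fderiv_apply hφ (EuclideanSpace.single j 1)) (hasCompactSupport_fderiv_apply hc _)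
  exact (i1.sub i2).sub (i3.const_mul _)

theorem integrable_greenTerm (hA : MemW1infComp A) (hu : MemH2loc u) (hv : MemH2loc v)
    {φ : E3 → ℝ} (hφ : ContDiff ℝ ∞ φ) (hc : HasCompactSupport φ) (j : Fin 3) :
    Integrable (greenTerm A φ u v j) volH := by
  have h1 := integrable_halfTerm hA (hu.magPartial hA j) hv.memH1loc hφ hc j
  have h2 := integrable_halfTerm hA (hv.magPartial hA j) hu.memH1loc hφ hc j
  have h3 : Integrable (fun x => conj (halfTerm A φ (magPartial A j v) u j x)) volH :=
    (Complex.conjLIE.toContinuousLinearEquiv.toContinuousLinearMap).integrable_comp h2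
  exact (h1.sub h3).congr (ae_of_all _ fun x => (greenTerm_eq A φ u v j x).symm)

theorem integral_greenTerm (hA : MemW1infComp A) (hu : MemH2loc u) (hv : MemH2loc v)
    {φ : E3 → ℝ} (hφ : ContDiff ℝ ∞ φ) (hc : HasCompactSupport φ) (j : Fin 3) :
    ∫ x, greenTerm A φ u v j x ∂volH =
      ∫ x, halfTerm A φ (magPartial A j u) v j x ∂volH -
        conj (∫ x, halfTerm A φ (magPartial A j v) u j x ∂volH) := by
  have h1 := integrable_halfTerm hA (hu.magPartial hA j) hv.memH1loc hφ hc j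
  have h2 := integrable_halfTerm hA (hv.magPartial hA j) hu.memH1loc hφ hc j
  have h3 : Integrable (fun x => conj (halfTerm A φ (magPartial A j v) u j x)) volH :=
    (Complex.conjLIE.toContinuousLinearEquiv.toContinuousLinearMap).integrable_comp h2
  rw [← integral_conj, ← integral_sub h1 h3]
  simp only [greenTerm_eq]

/-- The localized magnetic Green formula. -/
theorem integral_sum_greenTerm (hA : MemW1infComp A) (hu : MemH2loc u) (hv : MemH2loc v)
    {φ : E3 → ℝ} (hφ : ContDiff ℝ ∞ φ) (hc : HasCompactSupport φ) :
    ∫ x, ∑ j, greenTerm A φ u v j x ∂volH =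
      ∫ y, φ (pt y 0) • (mulConj (boundaryTrace u) (magNormalDeriv A v) y -
        mulConj (magNormalDeriv A u) (boundaryTrace v) y) := by
  rw [integral_finsetSum _ fun j _ => integrable_greenTerm hA hu hv hφ hc j]
  have ht : ∀ j : Fin 3, j ≠ 2 → ∫ x, greenTerm A φ u v j x ∂volH = 0 := by
    intro j hj
    rw [integral_greenTerm hA hu hv hφ hc]
    simp only [halfTerm]
    rw [magGreen_tangential A hj (hu.magPartial hA j) hv.memH1loc hφ hc,
      magGreen_tangential A hj (hv.magPartial hA j) hu.memH1loc hφ hc]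
    simp
  rw [Fin.sum_univ_three, ht 0 (by decide), ht 1 (by decide), zero_add, zero_add,
    integral_greenTerm hA hu hv hφ hc]
  simp only [halfTerm]
  rw [magGreen_normal A (hu.magPartial hA 2) hv.memH1loc (isTrace_magPartial hu hA) hv.isTrace
      hφ hc,
    magGreen_normal A (hv.magPartial hA 2) hu.memH1loc (isTrace_magPartial hv hA) hu.isTrace
      hφ hc, map_mul, ← integral_conj, ← integral_const_mul, ← integral_const_mul]
  have i1 := integrable_smul_mul_trace (fun R => (isTrace_magPartial hu hA R).1)
    (fun R => (hv.isTrace.conj R).1) hφ.continuous hc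
  have i2 := integrable_smul_mul_trace (fun R => (isTrace_magPartial hv hA R).1)
    (fun R => (hu.isTrace.conj R).1) hφ.continuous hc
  have i3 : Integrable (fun y => conj (φ (pt y 0) •
      (-Complex.I * magNormalDeriv A v y * conj (boundaryTrace u y)))) :=
    (Complex.conjLIE.toContinuousLinearEquiv.toContinuousLinearMap).integrable_comp i2
  rw [← integral_sub (i1.const_mul _) (i3.const_mul _)]
  refine integral_congr_ae (ae_of_all _ fun y => ?_)
  simp only [mulConj, Complex.real_smul, map_mul, map_neg, Complex.conj_I, Complex.conj_ofReal,
    Complex.conj_conj]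
  -- One factor `-i` comes from the integration by parts and one from the trace of the magnetic
  -- derivative; their product `-1` fixes the signs.
  linear_combination ((φ (pt y 0) : ℂ) * (magNormalDeriv A u y * conj (boundaryTrace v y) -
    boundaryTrace u y * conj (magNormalDeriv A v y))) * Complex.I_sq

end

/-! ### Radial cutoffs. -/

section

theorem deriv_smoothTransition_nonneg (s : ℝ) : 0 ≤ deriv Real.smoothTransition s :=
  Real.smoothTransition.monotone.deriv_nonneg

theorem deriv_smoothTransition_eq_zero {s : ℝ} (hs : s < 0 ∨ 1 < s) :
    deriv Real.smoothTransition s = 0 := by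
  rcases hs with hs | hs
  · have : Real.smoothTransition =ᶠ[𝓝 s] fun _ => 0 := by
      filter_upwards [Iio_mem_nhds hs] with t ht
      exact Real.smoothTransition.zero_of_nonpos (le_of_lt ht)
    rw [this.deriv_eq]; simp
  · have : Real.smoothTransition =ᶠ[𝓝 s] fun _ => 1 := by
      filter_upwards [Ioi_mem_nhds hs] with t ht
      exact Real.smoothTransition.one_of_one_le (le_of_lt ht)
    rw [this.deriv_eq]; simp

theorem continuous_deriv_smoothTransition : Continuous (deriv Real.smoothTransition) :=
  (Real.smoothTransition.contDiff (n := 1)).continuous_deriv (by simp)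

theorem exists_bound_deriv_smoothTransition :
    ∃ M, 0 ≤ M ∧ ∀ s, deriv Real.smoothTransition s ≤ M := by
  obtain ⟨M, hM⟩ := (isCompact_Icc (a := (0 : ℝ)) (b := 1)).exists_bound_of_continuousOn
    continuous_deriv_smoothTransition.continuousOn
  refine ⟨max M 0, le_max_right _ _, fun s => ?_⟩
  by_cases hs : s ∈ Set.Icc (0 : ℝ) 1
  · exact (le_abs_self _).trans ((hM s hs).trans (le_max_left _ _))
  · rw [deriv_smoothTransition_eq_zero]
    · exact le_max_right _ _
    · by_contra h
      push Not at h
      exact hs h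

/-- A radial cutoff, equal to `1` on the ball of radius `R` and to `0` outside that of
radius `2 R`. -/
def radialCutoff (R : ℝ) (x : E3) : ℝ := Real.smoothTransition (2 - ‖x‖ ^ 2 / R ^ 2)

/-- Minus the radial derivative of `radialCutoff`. -/
def radialWeight (R : ℝ) (x : E3) : ℝ :=
  deriv Real.smoothTransition (2 - ‖x‖ ^ 2 / R ^ 2) * (2 * ‖x‖ / R ^ 2)

theorem contDiff_radialCutoff (R : ℝ) : ContDiff ℝ ∞ (radialCutoff R) := by
  unfold radialCutoff
  exact Real.smoothTransition.contDiff.comp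
    (contDiff_const.sub ((contDiff_norm_sq ℝ).div_const _))

variable {R : ℝ}

theorem radialCutoff_eq_zero (hR : 0 < R) {x : E3} (hx : 2 * R ≤ ‖x‖) : radialCutoff R x = 0 := by
  refine Real.smoothTransition.zero_of_nonpos ?_
  rw [sub_nonpos, le_div_iff₀ (by positivity)]
  nlinarith

theorem radialCutoff_eq_one (hR : 0 < R) {x : E3} (hx : ‖x‖ ≤ R) : radialCutoff R x = 1 := by
  refine Real.smoothTransition.one_of_one_le ?_
  have : ‖x‖ ^ 2 / R ^ 2 ≤ 1 := by
    rw [div_le_one (by positivity)]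
    exact pow_le_pow_left₀ (norm_nonneg _) hx 2
  linarith

theorem radialWeight_eq_zero_of_lt (hR : 0 < R) {x : E3} (hx : ‖x‖ < R) :
    radialWeight R x = 0 := by
  rw [radialWeight, deriv_smoothTransition_eq_zero, zero_mul]
  right
  have : ‖x‖ ^ 2 / R ^ 2 < 1 := by
    rw [div_lt_one (by positivity)]
    exact pow_lt_pow_left₀ hx (norm_nonneg _) (by norm_num)
  linarith

theorem radialWeight_eq_zero_of_le (hR : 0 < R) {x : E3} (hx : 2 * R ≤ ‖x‖) :
    radialWeight R x = 0 := by
  rw [radialWeight, deriv_smoothTransition_eq_zero, zero_mul]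
  left
  rw [sub_neg, lt_div_iff₀ (by positivity)]
  nlinarith

theorem radialWeight_nonneg (R : ℝ) (x : E3) : 0 ≤ radialWeight R x :=
  mul_nonneg (deriv_smoothTransition_nonneg _) (by positivity)

theorem continuous_radialWeight (R : ℝ) : Continuous (radialWeight R) := by
  unfold radialWeight
  exact (continuous_deriv_smoothTransition.comp (by fun_prop)).mul (by fun_prop)

theorem hasCompactSupport_of_norm {f : E3 → ℝ} {R : ℝ} (h : ∀ x, R ≤ ‖x‖ → f x = 0) :
    HasCompactSupport f :=
  HasCompactSupport.intro (isCompact_closedBall (0 : E3) R) fun x hx => h x (by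
    simp only [mem_closedBall_zero_iff, not_le] at hx
    exact hx.le)

theorem hasCompactSupport_radialCutoff (hR : 0 < R) : HasCompactSupport (radialCutoff R) :=
  hasCompactSupport_of_norm fun _ => radialCutoff_eq_zero hR

theorem hasCompactSupport_radialWeight (hR : 0 < R) : HasCompactSupport (radialWeight R) :=
  hasCompactSupport_of_norm fun _ => radialWeight_eq_zero_of_le hR

theorem norm_radialCutoff_le (R : ℝ) (x : E3) : ‖radialCutoff R x‖ ≤ 1 := by
  rw [radialCutoff, Real.norm_of_nonneg (Real.smoothTransition.nonneg _)]
  exact Real.smoothTransition.le_one _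

theorem fderiv_radialCutoff (R : ℝ) (x : E3) (j : Fin 3) :
    fderiv ℝ (radialCutoff R) x (EuclideanSpace.single j 1) = -(radialWeight R x * (x j / ‖x‖)) := by
  have h1 : HasFDerivAt (fun x : E3 => 2 - ‖x‖ ^ 2 / R ^ 2)
      (-((R ^ 2)⁻¹ • (2 • innerSL ℝ x))) x := by
    have h2 := ((hasStrictFDerivAt_norm_sq x).hasFDerivAt.const_mul ((R ^ 2)⁻¹)).const_sub 2
    simpa only [div_eq_inv_mul] using h2
  have h3 : HasDerivAt Real.smoothTransition
      (deriv Real.smoothTransition (2 - ‖x‖ ^ 2 / R ^ 2)) (2 - ‖x‖ ^ 2 / R ^ 2) :=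
    ((Real.smoothTransition.contDiff (n := 1)).differentiable (by simp) _).hasDerivAt
  have h4 := h3.comp_hasFDerivAt x h1
  have h5 : HasFDerivAt (radialCutoff R) _ x := h4
  rw [h5.fderiv]
  simp only [radialWeight, smul_apply, neg_apply, innerSL_apply_apply, EuclideanSpace.inner_single_right]
  by_cases hx : ‖x‖ = 0
  · have : x = 0 := norm_eq_zero.1 hx
    simp [this]
  · simp
    field_simp

/-- The weight is at most `4M/R` and lives on the shell `R ≤ |x| < 2R`, where `1/|x|² ≤ 1/R²`. The
ball of radius `2R` has volume `8R³V`, so the powers of `R` cancel and `32MV` remains. -/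
theorem exists_bound_radialWeight_div : ∃ K : ℝ, 0 ≤ K ∧ ∀ R : ℝ, 0 < R →
    Integrable (fun x => radialWeight R x * (1 / ‖x‖ ^ 2)) volH ∧
    ∫ x, radialWeight R x * (1 / ‖x‖ ^ 2) ∂volH ≤ K := by
  obtain ⟨M, hM0, hM⟩ := exists_bound_deriv_smoothTransition
  set V := (volume : Measure E3).real (Metric.ball 0 1) with hV
  refine ⟨32 * M * V, by positivity, fun R hR => ?_⟩
  have hb : ∀ x : E3, radialWeight R x * (1 / ‖x‖ ^ 2) ≤
      (Metric.ball (0 : E3) (2 * R)).indicator (fun _ => 4 * M / R ^ 3) x := by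
    intro x
    rcases lt_or_ge ‖x‖ R with h1 | h1
    · rw [radialWeight_eq_zero_of_lt hR h1, zero_mul]
      exact Set.indicator_nonneg (fun _ _ => by positivity) _
    rcases lt_or_ge ‖x‖ (2 * R) with h2 | h2
    · rw [Set.indicator_of_mem (by simpa using h2)]
      have g1 : radialWeight R x ≤ 4 * M / R := by
        have : 2 * ‖x‖ / R ^ 2 ≤ 4 / R := by
          rw [div_le_div_iff₀ (by positivity) hR]
          nlinarith [mul_pos hR hR]
        calc radialWeight R x ≤ M * (4 / R) :=
              mul_le_mul (hM _) this (by positivity) hM0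
          _ = 4 * M / R := by ring
      have g2 : 1 / ‖x‖ ^ 2 ≤ 1 / R ^ 2 :=
        one_div_le_one_div_of_le (by positivity) (pow_le_pow_left₀ hR.le h1 2)
      calc radialWeight R x * (1 / ‖x‖ ^ 2) ≤ (4 * M / R) * (1 / R ^ 2) :=
            mul_le_mul g1 g2 (by positivity) (by positivity)
        _ = 4 * M / R ^ 3 := by field_simp
    · rw [radialWeight_eq_zero_of_le hR h2, zero_mul]
      exact Set.indicator_nonneg (fun _ _ => by positivity) _
  have hn : ∀ x : E3, 0 ≤ radialWeight R x * (1 / ‖x‖ ^ 2) := fun x =>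
    mul_nonneg (radialWeight_nonneg R x) (by positivity)
  have hI : Integrable ((Metric.ball (0 : E3) (2 * R)).indicator (fun _ => 4 * M / R ^ 3)) := by
    rw [integrable_indicator_iff measurableSet_ball]
    exact integrableOn_const measure_ball_lt_top.ne
  have hI' := hI.mono_measure (Measure.restrict_le_self : volH ≤ volume)
  have hm : AEStronglyMeasurable (fun x => radialWeight R x * (1 / ‖x‖ ^ 2)) volH := by
    have := (continuous_radialWeight R).measurable
    have h2 : Measurable fun x : E3 => (1 / ‖x‖ ^ 2 : ℝ) := by fun_prop
    exact (this.mul h2).aestronglyMeasurable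
  have hint := hI'.mono' hm (ae_of_all _ fun x => by
    rw [Real.norm_of_nonneg (hn x)]; exact hb x)
  refine ⟨hint, ?_⟩
  calc ∫ x, radialWeight R x * (1 / ‖x‖ ^ 2) ∂volH
      ≤ ∫ x, (Metric.ball (0 : E3) (2 * R)).indicator (fun _ => 4 * M / R ^ 3) x ∂volH :=
        integral_mono hint hI' hb
    _ ≤ ∫ x, (Metric.ball (0 : E3) (2 * R)).indicator (fun _ => 4 * M / R ^ 3) x :=
        integral_mono_measure Measure.restrict_le_self
          (ae_of_all _ fun x => Set.indicator_nonneg (fun _ _ => by positivity) _) hI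
    _ = 32 * M * V := by
        rw [integral_indicator measurableSet_ball, setIntegral_const, Measure.real,
          Measure.addHaar_ball _ _ (by positivity), ENNReal.toReal_mul,
          ENNReal.toReal_ofReal (by positivity)]
        rw [hV, Measure.real]
        simp only [finrank_euclideanSpace, Fintype.card_fin, smul_eq_mul]
        field_simp
        ring

/-! ### Flux through large spheres and the radiation condition. -/

variable {A : E3 → E3} {u v w : E3 → ℂ} {k : ℝ}

/-- The second order part of the Green integrand. -/
def greenDensity (A : E3 → E3) (u v : E3 → ℂ) (x : E3) : ℂ :=
  ∑ j, (magPartial A j (magPartial A j u) x * conj (v x) -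
    u x * conj (magPartial A j (magPartial A j v) x))

/-- The boundary integrand of Green's formula. -/
def greenBoundary (A : E3 → E3) (u v : E3 → ℂ) (y : E2) : ℂ :=
  mulConj (boundaryTrace u) (magNormalDeriv A v) y -
    mulConj (magNormalDeriv A u) (boundaryTrace v) y

/-- The flux integrand of Green's formula. -/
def greenFlux (u v : E3 → ℂ) (x : E3) : ℂ :=
  radialDeriv u x * conj (v x) - u x * conj (radialDeriv v x)

/-- Where the weight is nonzero, `A = 0` and the magnetic derivatives are `-i∂ⱼ`. The gradient of
the cutoff being radial, the first order terms add up to the weighted radial flux. -/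
theorem sum_greenTerm_radialCutoff {x : E3} (hx : A x = 0 ∨ radialWeight R x = 0) :
    ∑ j, greenTerm A (radialCutoff R) u v j x =
      radialCutoff R x • greenDensity A u v x + radialWeight R x • greenFlux u v x := by
  have h1 : ∀ j, greenTerm A (radialCutoff R) u v j x =
      radialCutoff R x • (magPartial A j (magPartial A j u) x * conj (v x) -
        u x * conj (magPartial A j (magPartial A j v) x)) + radialWeight R x •
        (((x j / ‖x‖ : ℝ) : ℂ) * weakPartial j u x * conj (v x) -
          u x * conj (((x j / ‖x‖ : ℝ) : ℂ) * weakPartial j v x)) := by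
    intro j
    rw [greenTerm, fderiv_radialCutoff]
    rw [sub_eq_add_neg]
    congr 1
    rcases hx with hx | hx
    · simp only [magPartial, hx, Complex.real_smul, map_mul, map_neg, Complex.conj_I,
        Complex.conj_ofReal, PiLp.zero_apply, Complex.ofReal_zero, zero_mul, add_zero]
      push_cast
      linear_combination (-(radialWeight R x : ℂ) * (x j / ‖x‖) * (weakPartial j u x * conj (v x)
        - u x * conj (weakPartial j v x))) * Complex.I_sq
    · simp [hx]
  simp only [h1, Finset.sum_add_distrib, ← Finset.smul_sum, Finset.sum_sub_distrib,
    ← Finset.sum_mul, ← Finset.mul_sum, greenDensity, greenFlux, radialDeriv, map_sum]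

theorem MemH1loc.radialDeriv (hu : MemH1loc u) : MemL2loc (radialDeriv u) := by
  have h : ∀ j : Fin 3, MemL2loc fun x => ((x j / ‖x‖ : ℝ) : ℂ) * weakPartial j u x := by
    intro j
    refine (hu.hasL2Partial j).2.bdd_mul ?_ fun R => ⟨1, ae_of_all _ fun x _ => ?_⟩
    · have : Measurable fun x : E3 => ((x j / ‖x‖ : ℝ) : ℂ) := by fun_prop
      exact this.aestronglyMeasurable
    · rw [Complex.norm_real, norm_div, norm_norm]
      exact div_le_one_of_le₀ (PiLp.norm_apply_le x j) (norm_nonneg _)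
  have h2 := ((h 0).add (h 1)).add (h 2)
  refine h2.congr (ae_of_all _ fun x => ?_)
  simp only [HalfSpace.radialDeriv, Fin.sum_univ_three]

theorem integrable_weight_flux (hu : MemH1loc u) (hv : MemH1loc v) (hR : 0 < R) :
    Integrable (fun x => radialWeight R x • greenFlux u v x) volH := by
  have i1 := hu.radialDeriv.integrable_smul_mul hv.1.conj (continuous_radialWeight R)
    (hasCompactSupport_radialWeight hR)
  have i2 := hu.1.integrable_smul_mul hv.radialDeriv.conj (continuous_radialWeight R)
    (hasCompactSupport_radialWeight hR)
  exact (i1.sub i2).congr (ae_of_all _ fun x => (smul_sub _ _ _).symm)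

theorem integrable_weight_norm_sq (hu : MemL2loc u) (hR : 0 < R) :
    Integrable (fun x => radialWeight R x * ‖u x‖ ^ 2) volH := by
  have i1 := (hu.integrable_smul_mul hu.conj (continuous_radialWeight R)
    (hasCompactSupport_radialWeight hR)).re
  refine i1.congr (ae_of_all _ fun x => ?_)
  simp only [Complex.mul_conj, Complex.normSq_eq_norm_sq, Complex.real_smul]
  rw [← Complex.ofReal_mul]
  exact Complex.ofReal_re _

theorem integrable_cutoff_smul {X : Type*} [MeasurableSpace X] {μ : Measure X} {F : X → ℂ}
    (hF : Integrable F μ) {c : X → ℝ} (hc : AEStronglyMeasurable c μ) (h1 : ∀ x, ‖c x‖ ≤ 1) :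
    Integrable (fun x => c x • F x) μ ∧ ‖∫ x, c x • F x ∂μ‖ ≤ ∫ x, ‖F x‖ ∂μ := by
  refine ⟨hF.bdd_smul 1 hc (ae_of_all _ h1), (norm_integral_le_integral_norm _).trans ?_⟩
  refine integral_mono_of_nonneg (ae_of_all _ fun x => norm_nonneg _) hF.norm
    (ae_of_all _ fun x => ?_)
  simp only [norm_smul]
  exact mul_le_of_le_one_left (norm_nonneg _) (h1 x)

theorem continuous_radialCutoff_pt (R : ℝ) : Continuous fun y : E2 => radialCutoff R (pt y 0) :=
  (contDiff_radialCutoff R).continuous.comp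
    (continuous_pt.comp (continuous_id.prodMk continuous_const))

theorem MemW1infComp.exists_radius (hA : MemW1infComp A) :
    ∃ R₀ : ℝ, 0 < R₀ ∧ ∀ x, R₀ ≤ ‖x‖ → A x = 0 := by
  obtain ⟨R, hR⟩ := hA.2.isCompact.isBounded.subset_ball (0 : E3)
  refine ⟨max R 1, by positivity, fun x hx => image_eq_zero_of_notMem_tsupport fun h => ?_⟩
  have := hR h
  rw [mem_ball_zero_iff] at this
  exact absurd ((le_max_left _ _).trans hx) (not_le.2 this)

/-- Green's formula with a radial cutoff. -/
theorem integral_weight_flux (hA : MemW1infComp A) (hu : MemH2loc u) (hv : MemH2loc v)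
    (hF : Integrable (greenDensity A u v) volH) (hR : 0 < R) (hAR : ∀ x, R ≤ ‖x‖ → A x = 0) :
    ∫ x, radialWeight R x • greenFlux u v x ∂volH =
      (∫ y, radialCutoff R (pt y 0) • greenBoundary A u v y) -
        ∫ x, radialCutoff R x • greenDensity A u v x ∂volH := by
  have key := integral_sum_greenTerm hA hu hv (contDiff_radialCutoff R)
    (hasCompactSupport_radialCutoff hR)
  have h1 : ∀ x, ∑ j, greenTerm A (radialCutoff R) u v j x =
      radialCutoff R x • greenDensity A u v x + radialWeight R x • greenFlux u v x := by
    intro x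
    refine sum_greenTerm_radialCutoff ?_
    rcases lt_or_ge ‖x‖ R with h | h
    · exact Or.inr (radialWeight_eq_zero_of_lt hR h)
    · exact Or.inl (hAR x h)
  simp only [h1] at key
  rw [integral_add (integrable_cutoff_smul hF
      (contDiff_radialCutoff R).continuous.aestronglyMeasurable (norm_radialCutoff_le R)).1
    (integrable_weight_flux hu.memH1loc hv.memH1loc hR)] at key
  rw [eq_sub_iff_add_eq', key]
  rfl

theorem Sommerfeld.eventually {κ : ℝ} (h : Sommerfeld κ w) {ε : ℝ} (hε : 0 < ε) :
    ∃ R₀ : ℝ, ∀ᵐ x ∂volH, R₀ ≤ ‖x‖ →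
      ‖x‖ * ‖radialDeriv w x - Complex.I * (κ : ℂ) * w x‖ ≤ ε := by
  obtain ⟨s, hs, t, ht, hst⟩ := eventually_inf.1 ((Metric.tendsto_nhds.1 h) ε hε)
  have hb : Bornology.IsBounded sᶜ :=
    Bornology.isBounded_compl_iff.2 (Bornology.isCobounded_def.2 hs)
  obtain ⟨R, hR⟩ := hb.subset_ball (0 : E3)
  refine ⟨R, ?_⟩
  filter_upwards [ht] with x hx hxR
  have hxs : x ∈ s := by
    by_contra hn
    have := hR hn
    rw [mem_ball_zero_iff] at this
    exact absurd hxR (not_le.2 this)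
  have h2 := hst x ⟨hxs, hx⟩
  rw [dist_zero_right, norm_mul, Complex.norm_real, norm_norm] at h2
  exact h2.le

/-- The cross term in the expanded square is exactly the flux. A bound on the flux and on the
radiation error `a - iκb` therefore controls `b`. -/
theorem sq_norm_radiation (κ : ℝ) (a b : ℂ) :
    ‖a - Complex.I * (κ : ℂ) * b‖ ^ 2 + (-Complex.I * (κ : ℂ) * (a * conj b - b * conj a)).re =
      ‖a‖ ^ 2 + κ ^ 2 * ‖b‖ ^ 2 := by
  simp only [Complex.sq_norm, Complex.normSq_apply]
  simp
  ring

/-- A radiating function has bounded mean square over large spheres. -/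
theorem exists_bound_weight_norm_sq (hA : MemW1infComp A) (hw : MemH2loc w) {κ : ℝ} (hκ : κ ≠ 0)
    (hS : Sommerfeld κ w) (hF : Integrable (greenDensity A w w) volH)
    (hB : Integrable (greenBoundary A w w)) :
    ∃ C R₀ : ℝ, 0 < R₀ ∧ ∀ R, R₀ ≤ R → ∫ x, radialWeight R x * ‖w x‖ ^ 2 ∂volH ≤ C := by
  obtain ⟨R₁, hR₁, hA0⟩ := hA.exists_radius
  obtain ⟨R₂, hR₂⟩ := hS.eventually one_pos
  obtain ⟨K, hK0, hK⟩ := exists_bound_radialWeight_div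
  set D := (∫ y, ‖greenBoundary A w w y‖) + ∫ x, ‖greenDensity A w w x‖ ∂volH with hD
  refine ⟨(K + |κ| * D) / κ ^ 2, max R₁ R₂, lt_max_of_lt_left hR₁, fun R hR => ?_⟩
  have hRpos : 0 < R := hR₁.trans_le ((le_max_left _ _).trans hR)
  obtain ⟨iK, bK⟩ := hK R hRpos
  have iw := integrable_weight_norm_sq hw.1 hRpos
  have iflux := integrable_weight_flux hw.memH1loc hw.memH1loc hRpos
  -- Green's formula for `w` with itself bounds the flux by `D`, which does not depend on `R`.
  have bflux : ‖∫ x, radialWeight R x • greenFlux w w x ∂volH‖ ≤ D := by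
    rw [integral_weight_flux hA hw hw hF hRpos
      fun x hx => hA0 x (((le_max_left _ _).trans hR).trans hx)]
    refine (norm_sub_le _ _).trans (add_le_add ?_ ?_)
    · exact (integrable_cutoff_smul hB (continuous_radialCutoff_pt R).aestronglyMeasurable
        fun y => norm_radialCutoff_le R _).2
    · exact (integrable_cutoff_smul hF (contDiff_radialCutoff R).continuous.aestronglyMeasurable
        (norm_radialCutoff_le R)).2
  -- `‖∂w/∂r‖ ^ 2` is dropped from `sq_norm_radiation`, and the radiation error is at most `1/|x|`
  -- by the Sommerfeld condition with tolerance `1`.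
  have hpt : ∀ᵐ x ∂volH, κ ^ 2 * (radialWeight R x * ‖w x‖ ^ 2) ≤
      radialWeight R x * (1 / ‖x‖ ^ 2) +
        (-Complex.I * (κ : ℂ) * (radialWeight R x • greenFlux w w x)).re := by
    filter_upwards [hR₂] with x hx
    rcases lt_or_ge ‖x‖ R with h1 | h1
    · simp [radialWeight_eq_zero_of_lt hRpos h1]
    · have hx0 : 0 < ‖x‖ := hRpos.trans_le h1
      have h2 := hx (((le_max_right _ _).trans hR).trans h1)
      have h3 : ‖radialDeriv w x - Complex.I * (κ : ℂ) * w x‖ ^ 2 ≤ 1 / ‖x‖ ^ 2 := by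
        rw [le_div_iff₀ (by positivity), ← mul_pow, mul_comm]
        exact pow_le_one₀ (by positivity) h2
      have h4 := sq_norm_radiation κ (radialDeriv w x) (w x)
      have h5 : (-Complex.I * (κ : ℂ) * (radialWeight R x • greenFlux w w x)).re =
          radialWeight R x * (-Complex.I * (κ : ℂ) * (radialDeriv w x * conj (w x) -
            w x * conj (radialDeriv w x))).re := by
        rw [mul_smul_comm, Complex.smul_re, smul_eq_mul, greenFlux]
      rw [h5, ← mul_add]
      calc κ ^ 2 * (radialWeight R x * ‖w x‖ ^ 2) = radialWeight R x * (κ ^ 2 * ‖w x‖ ^ 2) := by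
            ring
        _ ≤ _ := mul_le_mul_of_nonneg_left (by nlinarith [sq_nonneg ‖radialDeriv w x‖])
          (radialWeight_nonneg R x)
  rw [le_div_iff₀ (by positivity), mul_comm, ← integral_const_mul]
  have ire : Integrable (fun x => (-Complex.I * (κ : ℂ) *
      (radialWeight R x • greenFlux w w x)).re) volH := (iflux.const_mul _).re
  refine (integral_mono_ae (iw.const_mul _) (iK.add ire) hpt).trans ?_
  have e : ∫ x, (radialWeight R x * (1 / ‖x‖ ^ 2) +
      (-Complex.I * (κ : ℂ) * (radialWeight R x • greenFlux w w x)).re) ∂volH =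
      (∫ x, radialWeight R x * (1 / ‖x‖ ^ 2) ∂volH) +
        (-Complex.I * (κ : ℂ) * ∫ x, radialWeight R x • greenFlux w w x ∂volH).re := by
    rw [integral_add iK ire, ← integral_const_mul]
    congr 1
    exact integral_re (iflux.const_mul _)
  refine e.le.trans (add_le_add bK ((Complex.re_le_norm _).trans ?_))
  rw [norm_mul, norm_mul, norm_neg, Complex.norm_I, one_mul, Complex.norm_real, Real.norm_eq_abs]
  exact mul_le_mul_of_nonneg_left bflux (abs_nonneg _)

/-- The flux through large spheres of an outgoing against an incoming function tends to zero. -/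
theorem tendsto_weight_flux (hu : MemH2loc u) (hv : MemH2loc v) (hSu : Sommerfeld k u)
    (hSv : Sommerfeld (-k) v)
    (hbu : ∃ C R₀ : ℝ, 0 < R₀ ∧ ∀ R, R₀ ≤ R → ∫ x, radialWeight R x * ‖u x‖ ^ 2 ∂volH ≤ C)
    (hbv : ∃ C R₀ : ℝ, 0 < R₀ ∧ ∀ R, R₀ ≤ R → ∫ x, radialWeight R x * ‖v x‖ ^ 2 ∂volH ≤ C) :
    Tendsto (fun R => ∫ x, radialWeight R x • greenFlux u v x ∂volH) atTop (𝓝 0) := by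
  obtain ⟨Cu, Ru, hRu, hCu⟩ := hbu
  obtain ⟨Cv, Rv, -, hCv⟩ := hbv
  obtain ⟨K, hK0, hK⟩ := exists_bound_radialWeight_div
  rw [Metric.tendsto_atTop]
  intro δ hδ
  -- The final bound is `ε T = δ / 2`; the summand `1` only keeps `T` positive.
  set T := |Cu| + |Cv| + K + 1 with hT
  have hTpos : 0 < T := by positivity
  set ε := δ / (2 * T) with hε
  have hεpos : 0 < ε := by positivity
  obtain ⟨R₁, hR₁⟩ := hSu.eventually hεpos
  obtain ⟨R₂, hR₂⟩ := hSv.eventually hεpos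
  refine ⟨max (max Ru Rv) (max R₁ R₂), fun R hR => ?_⟩
  have hRu' : Ru ≤ R := ((le_max_left _ _).trans (le_max_left _ _)).trans hR
  have hRv' : Rv ≤ R := ((le_max_right _ _).trans (le_max_left _ _)).trans hR
  have hR₁' : R₁ ≤ R := ((le_max_left _ _).trans (le_max_right _ _)).trans hR
  have hR₂' : R₂ ≤ R := ((le_max_right _ _).trans (le_max_right _ _)).trans hR
  have hRpos : 0 < R := hRu.trans_le hRu'
  obtain ⟨iK, bK⟩ := hK R hRpos
  have iu := integrable_weight_norm_sq hu.1 hRpos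
  have iv := integrable_weight_norm_sq hv.1 hRpos
  have hpt : ∀ᵐ x ∂volH, ‖radialWeight R x • greenFlux u v x‖ ≤
      ε * (radialWeight R x * ‖u x‖ ^ 2 + radialWeight R x * ‖v x‖ ^ 2 +
        radialWeight R x * (1 / ‖x‖ ^ 2)) := by
    filter_upwards [hR₁, hR₂] with x h1 h2
    rcases lt_or_ge ‖x‖ R with h | h
    · simp [radialWeight_eq_zero_of_lt hRpos h]
    · have hx0 : 0 < ‖x‖ := hRpos.trans_le h
      have a1 := h1 (hR₁'.trans h)
      have a2 := h2 (hR₂'.trans h)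
      -- The opposite signs of the wave numbers make the added terms `± i k u v̄` cancel, so the
      -- flux involves only radiation errors.
      have e : greenFlux u v x = (radialDeriv u x - Complex.I * (k : ℂ) * u x) * conj (v x) -
          u x * conj (radialDeriv v x - Complex.I * ((-k : ℝ) : ℂ) * v x) := by
        simp only [greenFlux, map_sub, map_mul, Complex.conj_I, Complex.conj_ofReal]
        push_cast
        ring
      set a := ‖radialDeriv u x - Complex.I * (k : ℂ) * u x‖
      set b := ‖radialDeriv v x - Complex.I * ((-k : ℝ) : ℂ) * v x‖
      have b1 : ‖greenFlux u v x‖ ≤ a * ‖v x‖ + ‖u x‖ * b := by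
        rw [e]
        refine (norm_sub_le _ _).trans (le_of_eq ?_)
        rw [norm_mul, norm_mul, RCLike.norm_conj, RCLike.norm_conj]
      have a1' : a ≤ ε * (1 / ‖x‖) := by
        rw [mul_one_div, le_div_iff₀ hx0, mul_comm]; exact a1
      have a2' : b ≤ ε * (1 / ‖x‖) := by
        rw [mul_one_div, le_div_iff₀ hx0, mul_comm]; exact a2
      have b2 : ‖greenFlux u v x‖ ≤ ε * (‖u x‖ ^ 2 + ‖v x‖ ^ 2 + 1 / ‖x‖ ^ 2) := by
        have c1 := mul_le_mul_of_nonneg_right a1' (norm_nonneg (v x))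
        have c2 := mul_le_mul_of_nonneg_left a2' (norm_nonneg (u x))
        have c3 : (1 / ‖x‖) * ‖v x‖ + ‖u x‖ * (1 / ‖x‖) ≤
            ‖u x‖ ^ 2 + ‖v x‖ ^ 2 + 1 / ‖x‖ ^ 2 := by
          have : 1 / ‖x‖ ^ 2 = (1 / ‖x‖) ^ 2 := by ring
          rw [this]
          nlinarith [sq_nonneg (1 / ‖x‖ - ‖u x‖), sq_nonneg (1 / ‖x‖ - ‖v x‖),
            sq_nonneg ‖u x‖, sq_nonneg ‖v x‖]
        have c4 := mul_le_mul_of_nonneg_left c3 hεpos.le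
        linarith
      rw [norm_smul, Real.norm_of_nonneg (radialWeight_nonneg R x)]
      calc radialWeight R x * ‖greenFlux u v x‖
          ≤ radialWeight R x * (ε * (‖u x‖ ^ 2 + ‖v x‖ ^ 2 + 1 / ‖x‖ ^ 2)) :=
            mul_le_mul_of_nonneg_left b2 (radialWeight_nonneg R x)
        _ = _ := by ring
  rw [dist_zero_right]
  have hbound : ‖∫ x, radialWeight R x • greenFlux u v x ∂volH‖ ≤ ε * T := by
    refine (norm_integral_le_of_norm_le (((iu.add iv).add iK).const_mul ε) hpt).trans ?_
    rw [integral_const_mul]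
    refine mul_le_mul_of_nonneg_left ?_ hεpos.le
    have e : ∫ x, (radialWeight R x * ‖u x‖ ^ 2 + radialWeight R x * ‖v x‖ ^ 2
        + radialWeight R x * (1 / ‖x‖ ^ 2)) ∂volH =
        (∫ x, radialWeight R x * ‖u x‖ ^ 2 ∂volH) + (∫ x, radialWeight R x * ‖v x‖ ^ 2 ∂volH) +
          ∫ x, radialWeight R x * (1 / ‖x‖ ^ 2) ∂volH := by
      have iuv : Integrable (fun x => radialWeight R x * ‖u x‖ ^ 2 +
          radialWeight R x * ‖v x‖ ^ 2) volH := iu.add iv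
      rw [integral_add iuv iK, integral_add iu iv]
    refine e.le.trans ?_
    have := hCu R hRu'
    have := hCv R hRv'
    linarith [le_abs_self Cu, le_abs_self Cv]
  have : ε * T = δ / 2 := by
    rw [hε]; field_simp
  linarith

/-- The map `π` lets one statement serve both the half space and its boundary plane. -/
theorem tendsto_integral_cutoff_smul {X : Type*} [MeasurableSpace X] {μ : Measure X} {F : X → ℂ}
    (hF : Integrable F μ) {π : X → E3} (hπ : ∀ R, AEStronglyMeasurable
      (fun x => radialCutoff R (π x)) μ) :
    Tendsto (fun R => ∫ x, radialCutoff R (π x) • F x ∂μ) atTop (𝓝 (∫ x, F x ∂μ)) := by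
  refine tendsto_integral_filter_of_dominated_convergence (fun x => ‖F x‖)
    (Eventually.of_forall fun R => (hπ R).smul hF.1) (Eventually.of_forall fun R => ?_) hF.norm
    (ae_of_all _ fun x => ?_)
  · refine ae_of_all _ fun x => ?_
    rw [norm_smul]
    exact mul_le_of_le_one_left (norm_nonneg _) (norm_radialCutoff_le R _)
  · refine tendsto_const_nhds.congr' ?_
    filter_upwards [eventually_ge_atTop ‖π x‖, eventually_gt_atTop 0] with R h1 h2
    rw [radialCutoff_eq_one h2 h1, one_smul]

/-- The magnetic Green formula for a pair of radiating functions. -/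
theorem integral_greenDensity_eq (hA : MemW1infComp A) (hu : MemH2loc u) (hv : MemH2loc v)
    (hF : Integrable (greenDensity A u v) volH) (hB : Integrable (greenBoundary A u v))
    (hflux : Tendsto (fun R => ∫ x, radialWeight R x • greenFlux u v x ∂volH) atTop (𝓝 0)) :
    ∫ x, greenDensity A u v x ∂volH = ∫ y, greenBoundary A u v y := by
  obtain ⟨R₁, hR₁, hA0⟩ := hA.exists_radius
  have l1 := tendsto_integral_cutoff_smul hF (π := fun x => x)
    fun R => (contDiff_radialCutoff R).continuous.aestronglyMeasurable
  have l2 := tendsto_integral_cutoff_smul hB (π := fun y => pt y 0)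
    fun R => (continuous_radialCutoff_pt R).aestronglyMeasurable
  have l3 := l2.sub l1
  have l4 := hflux.congr' (f₂ := fun R => (∫ y, radialCutoff R (pt y 0) • greenBoundary A u v y) -
        ∫ x, radialCutoff R x • greenDensity A u v x ∂volH) (by
    filter_upwards [eventually_ge_atTop R₁] with R hR
    exact integral_weight_flux hA hu hv hF (hR₁.trans_le hR) fun x hx => hA0 x (hR.trans hx))
  exact (sub_eq_zero.1 (tendsto_nhds_unique l3 l4)).symm

/-! ### Integrability of the pairings and conclusion. -/

theorem EssCompactSupport.integrable {X : Type*} [NormedAddCommGroup X] [MeasurableSpace X]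
    [OpensMeasurableSpace X] {μ : Measure X} {f : X → ℂ} (hf : EssCompactSupport f μ)
    (h : ∀ R : ℝ, IntegrableOn f (Metric.ball 0 R) μ) : Integrable f μ := by
  obtain ⟨K, hK, h0⟩ := hf
  obtain ⟨R, hR⟩ := hK.isBounded.subset_ball (0 : X)
  rw [← integrableOn_univ]
  refine (h R).of_ae_sdiff_eq_zero MeasurableSet.univ.nullMeasurableSet ?_
  filter_upwards [h0] with x hx hx2
  exact hx fun hxK => hx2.2 (hR hxK)

theorem EssCompactSupport.mulConj_left {X : Type*} [TopologicalSpace X] [MeasurableSpace X]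
    {μ : Measure X} {f : X → ℂ} (hf : EssCompactSupport f μ) (g : X → ℂ) :
    EssCompactSupport (mulConj f g) μ := by
  obtain ⟨K, hK, h0⟩ := hf
  refine ⟨K, hK, ?_⟩
  filter_upwards [h0] with x hx hxK
  simp [mulConj, hx hxK]

theorem EssCompactSupport.mulConj_right {X : Type*} [TopologicalSpace X] [MeasurableSpace X]
    {μ : Measure X} {g : X → ℂ} (hg : EssCompactSupport g μ) (f : X → ℂ) :
    EssCompactSupport (mulConj f g) μ := by
  obtain ⟨K, hK, h0⟩ := hg
  refine ⟨K, hK, ?_⟩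
  filter_upwards [h0] with x hx hxK
  simp [mulConj, hx hxK]

theorem integrableOn_mulConj {X : Type*} [MeasurableSpace X] {μ : Measure X} {f g : X → ℂ}
    {s : Set X} (hf : MemLp f 2 (μ.restrict s)) (hg : MemLp g 2 (μ.restrict s)) :
    IntegrableOn (mulConj f g) s μ :=
  hf.integrable_mul hg.star

theorem integrable_mulConj_trace {f g : E2 → ℂ}
    (hf : ∀ R : ℝ, MemLp f 2 (volume.restrict (Metric.ball 0 R)))
    (hg : ∀ R : ℝ, MemLp g 2 (volume.restrict (Metric.ball 0 R)))
    (h : EssCompactSupport (mulConj f g) volume) : Integrable (mulConj f g) :=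
  h.integrable fun R => integrableOn_mulConj (hf R) (hg R)

theorem integrable_mulConj {f g : E3 → ℂ} (hf : MemL2loc f) (hg : MemL2loc g)
    (h : EssCompactSupport (mulConj f g) volH) : Integrable (mulConj f g) volH :=
  h.integrable fun R => integrableOn_mulConj (memL2loc_iff.1 hf R) (memL2loc_iff.1 hg R)

theorem MemL2comp.memL2loc {f : E3 → ℂ} (hf : MemL2comp f) : MemL2loc f :=
  memL2loc_iff.2 fun _ => hf.1.mono_measure Measure.restrict_le_self

theorem memL2comp_of_ae_eq_zero {f : E3 → ℂ} (hf : ∀ᵐ x ∂volH, f x = 0) : MemL2comp f := by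
  refine ⟨(memLp_congr_ae (f := fun _ => (0 : ℂ)) ?_).1 MemLp.zero', ∅, isCompact_empty, ?_⟩
  · filter_upwards [hf] with x hx using hx.symm
  · filter_upwards [hf] with x hx _ using hx

theorem MemLinfComp.conj {q : E3 → ℂ} (hq : MemLinfComp q) : MemLinfComp fun x => conj (q x) := by
  refine ⟨hq.1.star, ?_⟩
  obtain ⟨K, hK, h0⟩ := hq.2
  refine ⟨K, hK, ?_⟩
  filter_upwards [h0] with x hx hxK
  simp [hx hxK]

theorem MemLinfComp.mul {q : E3 → ℂ} (hq : MemLinfComp q) (hu : MemL2loc u) :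
    MemL2loc (fun x => q x * u x) ∧ EssCompactSupport (fun x => q x * u x) volH := by
  constructor
  · rw [memL2loc_iff] at *
    intro R
    exact MemLp.mul (p := ⊤) (q := 2) (hu R) (hq.1.mono_measure Measure.restrict_le_self)
  · obtain ⟨K, hK, h0⟩ := hq.2
    refine ⟨K, hK, ?_⟩
    filter_upwards [h0] with x hx hxK
    simp [hx hxK]

/-- The zeroth order terms cancel: `k` is real, and conjugation turns the potential `q̄` acting on
`v` back into `q`. -/
theorem greenDensity_eq (A : E3 → E3) (q : E3 → ℂ) (k : ℝ) (u v : E3 → ℂ) (x : E3) :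
    greenDensity A u v x = mulConj (helmholtz A q k u) v x -
      mulConj u (helmholtz A (fun x => conj (q x)) k v) x := by
  simp only [greenDensity, mulConj, helmholtz, magneticSchrodinger, map_sub, map_add, map_sum,
    map_mul, Complex.conj_conj, map_pow, Complex.conj_ofReal, Finset.sum_sub_distrib,
    ← Finset.sum_mul, ← Finset.mul_sum]
  ring

/-- For complex `q` the operator paired with itself leaves the terms `u conj(q u) - q u ū`; they are
harmless because `q` has compact support. -/
theorem integrable_greenDensity_self {q : E3 → ℂ} (hq : MemLinfComp q) (hu : MemL2loc u)
    (hf : MemL2comp (helmholtz A q k u)) : Integrable (greenDensity A u u) volH := by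
  obtain ⟨hqu, hqc⟩ := hq.mul hu
  have i1 := integrable_mulConj hf.memL2loc hu (hf.2.mulConj_left u)
  have i2 := integrable_mulConj hu hf.memL2loc (hf.2.mulConj_right u)
  have i3 := integrable_mulConj hqu hu (hqc.mulConj_left u)
  have i4 := integrable_mulConj hu hqu (hqc.mulConj_right u)
  refine (((i1.sub i2).sub i3).add i4).congr (ae_of_all _ fun x => ?_)
  rw [greenDensity_eq A q k u u]
  simp only [mulConj, helmholtz, magneticSchrodinger, map_sub, map_add, map_sum, map_mul,
    Complex.conj_conj, map_pow, Complex.conj_ofReal, Pi.add_apply, Pi.sub_apply]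
  ring

end

end HalfSpace

end

open HalfSpace in
theorem mainTheorem7 (k : ℝ) (hk : 0 < k)
    (A : HalfSpace.E3 → HalfSpace.E3) (hA : HalfSpace.MemW1infComp A)
    (q : HalfSpace.E3 → ℂ) (hq : HalfSpace.MemLinfComp q)
    (u v : HalfSpace.E3 → ℂ)
    (hu : HalfSpace.MemH2loc u)
    (hueq : ∀ᵐ x ∂HalfSpace.volH, HalfSpace.helmholtz A q k u x = 0)
    (hutr : HalfSpace.EssCompactSupport (HalfSpace.boundaryTrace u) volume)
    (huout : HalfSpace.Outgoing k u)
    (hv : HalfSpace.MemH2loc v)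
    (hveq : HalfSpace.MemL2comp
      (HalfSpace.helmholtz A (fun x => (starRingEnd ℂ) (q x)) k v))
    (hvtr : HalfSpace.EssCompactSupport (HalfSpace.boundaryTrace v) volume)
    (hvin : HalfSpace.Incoming k v) :
    Integrable (HalfSpace.mulConj (HalfSpace.helmholtz A q k u) v) HalfSpace.volH ∧
    Integrable (HalfSpace.mulConj u
      (HalfSpace.helmholtz A (fun x => (starRingEnd ℂ) (q x)) k v)) HalfSpace.volH ∧
    Integrable (HalfSpace.mulConj (HalfSpace.boundaryTrace u)
      (HalfSpace.magNormalDeriv A v)) volume ∧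
    Integrable (HalfSpace.mulConj (HalfSpace.magNormalDeriv A u)
      (HalfSpace.boundaryTrace v)) volume ∧
    (∫ x, HalfSpace.mulConj (HalfSpace.helmholtz A q k u) v x ∂HalfSpace.volH)
      - (∫ x, HalfSpace.mulConj u
          (HalfSpace.helmholtz A (fun x => (starRingEnd ℂ) (q x)) k v) x ∂HalfSpace.volH)
    = (∫ y, HalfSpace.mulConj (HalfSpace.boundaryTrace u) (HalfSpace.magNormalDeriv A v) y)
      - (∫ y, HalfSpace.mulConj (HalfSpace.magNormalDeriv A u)
          (HalfSpace.boundaryTrace v) y) := by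
  have hf : MemL2comp (helmholtz A q k u) := memL2comp_of_ae_eq_zero hueq
  have tu := fun R => (hu.isTrace R).1
  have tv := fun R => (hv.isTrace R).1
  have nu := memLp_magNormalDeriv hu hA
  have nv := memLp_magNormalDeriv hv hA
  have i1 := integrable_mulConj hf.memL2loc hv.1 (hf.2.mulConj_left v)
  have i2 := integrable_mulConj hu.1 hveq.memL2loc (hveq.2.mulConj_right u)
  have i3 := integrable_mulConj_trace tu nv (hutr.mulConj_left _)
  have i4 := integrable_mulConj_trace nu tv (hvtr.mulConj_right _)
  -- In both products one factor is the compactly supported trace of `u`.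
  have bu : Integrable (greenBoundary A u u) :=
    (integrable_mulConj_trace tu nu (hutr.mulConj_left _)).sub
      (integrable_mulConj_trace nu tu (hutr.mulConj_right _))
  have bv : Integrable (greenBoundary A v v) :=
    (integrable_mulConj_trace tv nv (hvtr.mulConj_left _)).sub
      (integrable_mulConj_trace nv tv (hvtr.mulConj_right _))
  have hF : Integrable (greenDensity A u v) volH :=
    (i1.sub i2).congr (ae_of_all _ fun x => (greenDensity_eq A q k u v x).symm)
  have wu := exists_bound_weight_norm_sq hA hu hk.ne' huout
    (integrable_greenDensity_self hq hu.1 hf) bu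
  -- The mean square bound needs only a nonzero wave number, so it applies to the incoming `v` with
  -- `κ = -k` and potential `q̄`.
  have wv := exists_bound_weight_norm_sq hA hv (neg_ne_zero.2 hk.ne') hvin
    (integrable_greenDensity_self hq.conj hv.1 hveq) bv
  have key := integral_greenDensity_eq hA hu hv hF (i3.sub i4)
    (tendsto_weight_flux hu hv huout hvin wu wv)
  refine ⟨i1, i2, i3, i4, ?_⟩
  rw [← integral_sub i1 i2, ← integral_sub i3 i4]
  simp only [← greenDensity_eq]
  exact key
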